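/- Setting. Let $(\Omega,\mathcal F,P)$ be a probability space, $\|X\|_p=\mathbb E[|X|^p]^{1/p}$, and let $H$ be a real Hilbert space (for instance $L^2(\mathcal T)$ with $\mathcal T\subset\mathbb R^d$ compact). Fix $\mathfrak a>0$, $\mathfrak h,p\ge 1$, $C>0$ and a sequence $s_n\ge 0$ with $s_n\to 0$. Put $\mathfrak d=\lceil \mathfrak h/\mathfrak a\rceil$ and $q=p\,2^{\mathfrak d+4}$. Let $m=m_n\ge 1$ with $m_n\to\infty$ and $J^+=J_n^+\in\mathbb N$. For every $n$ let the following be given (all objects may depend on $n$): (1) a bounded operator $D=\sum_{j\ge1}\lambda_j\langle e_j,\cdot\rangle e_j$ on $H$ with $(e_j)_{j\ge 1}$ orthonormal, $\lambda_1\ge\lambda_2\ge\dots\ge 0$ and $\sum_j\lambda_j<\infty$; (2) numbers $\tilde\lambda_j\ge 0$ with $\sum_j\tilde\lambda_j<\infty$, integrable real random variables $\eta_{i,j}$ and real random variables $\eta^{R}_{i,j}$ such that $D=\sum_{i,j}(\tilde\lambda_i\tilde\lambda_j)^{1/2}\,\mathbb E[\eta_{i,j}]\langle e_i,\cdot\rangle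 e_j$, and a random bounded symmetric operator $\hat D$ with, almost surely, $\hat D=\sum_{i,j}(\tilde\lambda_i\tilde\lambda_j)^{1/2}(\eta_{i,j}-\eta^{R}_{i,j})\langle e_i,\cdot\rangle e_j$ (all series converging unconditionally at every $x\in H$); (3) measurable $\hat\lambda_j$, $\hat e_j$ which almost surely are the eigenvalues of $\hat D$ in decreasing order (with multiplicity) and corresponding orthonormal eigenvectors, that is, $\hat D\hat e_j=\hat\lambda_j\hat e_j$, $\hat\lambda_1\ge\hat\lambda_2\ge\dots$, and $\langle\hat Dx,x\rangle\le\hat\lambda_j\|x\|^2$ whenever $x\perp\hat e_1,\dots,\hat e_{j-1}$; signs are chosen such that $\langle\hat e_j,e_j\rangle\ge0$. Write $\bar\eta_{i,j}=\eta_{i,j}-\mathbb E[\eta_{i,j}]$ and $\Lambda_j=\sum_{k\ne j}\frac{\lambda_j\lambda_k}{(\lambda_j-\lambda_k)^2}$. Assume that for every $n$ (A1) $m^{1/2}\|\bar\eta_{i,j}\|_q\le C$ and $m^{1/2}\|\eta^{R}_{i,j}\|_q\le s_n$ for all $i,j\ge1$; (A2) $m^{-1/2+\mathfrak a}\sum_{i\ne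 j}\frac{\lambda_i}{|\lambda_j-\lambda_i|}\le C$ and $m^{-1+2\mathfrak a}\Lambda_j\le C$ for $1\le j\le J^+$, and $\lambda_{J^+}\ge m^{-\mathfrak h}/C$; (A3) $1/C\le\mathbb E[\eta_{j,j}]\le C$ for all $j\ge 1$, and $\sum_j\lambda_j\le C$. Claim. There is a constant $K>0$, depending only on $\mathfrak a,\mathfrak h,p,C$ and $(s_n)$, such that for every $n$ the following holds. One has $\tilde\lambda_j=\lambda_j/\mathbb E[\eta_{j,j}]$ for all $j$; for $1\le j<J^+$ the two series over $k$ below converge almost surely; and for $1\le J<J^+$ $$\Bigl\|\max_{1\le j\le J}\Bigl|\tfrac1{\lambda_j}\bigl(\hat\lambda_j-\lambda_j-\tilde\lambda_j\bar\eta_{j,j}\bigr)\Bigr|\Bigr\|_p\le K\,\frac{J^{1/p}(m^{-\mathfrak a}+s_n)}{\sqrt m},$$ $$\Bigl\|\max_{1\le j\le J}\Bigl\|\tfrac1{\sqrt{\Lambda_j}}\Bigl(\hat e_j-e_j+\tfrac{e_j}{2}\|\hat e_j-e_j\|^2-\sum_{k\ne j}e_k\frac{(\tilde\lambda_k\tilde\lambda_j)^{1/2}\bar\eta_{k,j}}{\lambda_j-\lambda_k}\Bigr)\Bigr\|\Bigr\|_p\le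 K\,\frac{J^{1/p}(m^{-\mathfrak a}+s_n)}{\sqrt m},$$ $$\Bigl\|\max_{1\le j\le J}\Bigl|\tfrac1{\Lambda_j}\Bigl(\|\hat e_j-e_j\|^2-\sum_{k\ne j}\frac{\tilde\lambda_k\tilde\lambda_j\bar\eta_{k,j}^2}{(\lambda_j-\lambda_k)^2}\Bigr)\Bigr|\Bigr\|_p\le K\,\frac{J^{1/p}(m^{-\mathfrak a}+s_n)}{m}.$$ Consequently, for $1\le j<J^+$, $$\|\hat\lambda_j-\lambda_j\|_p\le K\frac{\lambda_j}{\sqrt m}\qquad\text{and}\qquad\bigl\|\|\hat e_j-e_j\|^2\bigr\|_p\le K\frac{\Lambda_j}{m}.$$ -/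

import Mathlib

open MeasureTheory Filter Topology
open scoped ENNReal

universe u v

/-- `(μ j, v j)`, `j = 1, 2, …`, are the eigenvalues of the operator `T`, listed in decreasing order
with multiplicity, together with orthonormal eigenvectors: `μ j` is the largest eigenvalue of `T` on
the orthogonal complement of `v 1, …, v (j - 1)`. -/
structure IsOrderedEigensystem {H : Type*} [NormedAddCommGroup H] [InnerProductSpace ℝ H]
    (T : H →L[ℝ] H) (μ : ℕ+ → ℝ) (v : ℕ+ → H) : Prop where
  orthonormal : Orthonormal ℝ v
  eigen : ∀ j, T (v j) = μ j • v j
  antitone : Antitone μ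
  leading : ∀ j x, (∀ i, i < j → inner ℝ (v i) x = 0) → inner ℝ (T x) x ≤ μ j * ‖x‖ ^ 2

/-- The objects of the framework, at one value of the size parameter:
the operator `D` with eigenvalues `lam` and eigenvectors `e`, the weights `lamT`, the scores
`etaD` (contributing part) and `etaR` (negligible part), the empirical operator `Dhat`, and its
eigenvalues `lamHat` and eigenvectors `eHat`. -/
structure EigenModel (Ω H : Type*) [NormedAddCommGroup H] [InnerProductSpace ℝ H] where
  D : H →L[ℝ] H
  lam : ℕ+ → ℝ
  e : ℕ+ → H
  lamT : ℕ+ → ℝ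
  etaD : ℕ+ → ℕ+ → Ω → ℝ
  etaR : ℕ+ → ℕ+ → Ω → ℝ
  Dhat : Ω → H →L[ℝ] H
  lamHat : ℕ+ → Ω → ℝ
  eHat : ℕ+ → Ω → H

namespace EigenModel

variable {Ω H : Type*} [MeasurableSpace Ω] [NormedAddCommGroup H] [InnerProductSpace ℝ H]

/-- The two representations
`D = ∑ j, λ j ⟨e j, ·⟩ e j = ∑ i j, √(λ̃ i λ̃ j) E[η i j] ⟨e i, ·⟩ e j` and
`D̂ = ∑ i j, √(λ̃ i λ̃ j) (η i j - ηᴿ i j) ⟨e i, ·⟩ e j`, where `D̂` is symmetric with ordered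
eigenvalues and orthonormal eigenvectors whose signs are chosen so that `⟨ê j, e j⟩ ≥ 0`. -/
structure IsRepresented (M : EigenModel Ω H) (P : Measure Ω) : Prop where
  lam_nonneg : ∀ j, 0 ≤ M.lam j
  lam_antitone : Antitone M.lam
  lam_summable : Summable M.lam
  e_orthonormal : Orthonormal ℝ M.e
  D_spectral : ∀ x, HasSum (fun j => (M.lam j * inner ℝ (M.e j) x) • M.e j) (M.D x)
  lamT_nonneg : ∀ j, 0 ≤ M.lamT j
  lamT_summable : Summable M.lamT
  etaD_integrable : ∀ i j, Integrable (M.etaD i j) P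
  etaR_measurable : ∀ i j, AEStronglyMeasurable (M.etaR i j) P
  D_scores : ∀ x, HasSum
    (fun ij : ℕ+ × ℕ+ =>
      (Real.sqrt (M.lamT ij.1 * M.lamT ij.2) * (∫ ω, M.etaD ij.1 ij.2 ω ∂P) *
        inner ℝ (M.e ij.1) x) • M.e ij.2) (M.D x)
  Dhat_scores : ∀ᵐ ω ∂P, ∀ x, HasSum
    (fun ij : ℕ+ × ℕ+ =>
      (Real.sqrt (M.lamT ij.1 * M.lamT ij.2) * (M.etaD ij.1 ij.2 ω - M.etaR ij.1 ij.2 ω) *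
        inner ℝ (M.e ij.1) x) • M.e ij.2) (M.Dhat ω x)
  Dhat_symmetric : ∀ᵐ ω ∂P, ∀ x y, inner ℝ (M.Dhat ω x) y = inner ℝ x (M.Dhat ω y)
  Dhat_eigen : ∀ᵐ ω ∂P,
    IsOrderedEigensystem (M.Dhat ω) (fun j => M.lamHat j ω) (fun j => M.eHat j ω)
  sign_convention : ∀ᵐ ω ∂P, ∀ j, 0 ≤ inner ℝ (M.eHat j ω) (M.e j)
  lamHat_measurable : ∀ j, AEStronglyMeasurable (M.lamHat j) P
  eHat_measurable : ∀ j, AEStronglyMeasurable (M.eHat j) P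

/-- `∑_{i ≠ j} λ i / |λ j - λ i|`, infinite if `λ j > 0` is a multiple eigenvalue. -/
noncomputable def gapSum (M : EigenModel Ω H) (j : ℕ+) : ℝ≥0∞ :=
  ∑' i : {i : ℕ+ // i ≠ j}, ENNReal.ofReal (M.lam i) / ENNReal.ofReal |M.lam j - M.lam i|

/-- `∑_{i ≠ j} λ i λ j / (λ j - λ i)²`, infinite if `λ j > 0` is a multiple eigenvalue. -/
noncomputable def gapSumSq (M : EigenModel Ω H) (j : ℕ+) : ℝ≥0∞ :=
  ∑' i : {i : ℕ+ // i ≠ j},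
    ENNReal.ofReal (M.lam i * M.lam j) / ENNReal.ofReal ((M.lam j - M.lam i) ^ 2)

/-- `Λ j = ∑_{k ≠ j} λ j λ k / (λ j - λ k)²` as a real number. -/
noncomputable def Lambda (M : EigenModel Ω H) (j : ℕ+) : ℝ := (M.gapSumSq j).toReal

/-- The centered score `η̄ k j = η k j - E[η k j]`. -/
noncomputable def etaBar (M : EigenModel Ω H) (P : Measure Ω) (k j : ℕ+) (ω : Ω) : ℝ :=
  M.etaD k j ω - ∫ ω', M.etaD k j ω' ∂P

/-- `(λ̃ k λ̃ j)^{1/2} η̄ k j`. -/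
noncomputable def scoreTerm (M : EigenModel Ω H) (P : Measure Ω) (k j : ℕ+) (ω : Ω) : ℝ :=
  Real.sqrt (M.lamT k * M.lamT j) * M.etaBar P k j ω

/-- The moment order `q = p 2^{𝔡 + 4}`, `𝔡 = ⌈𝔥 / 𝔞⌉`. -/
noncomputable def momentOrder (a h p : ℝ) : ℝ := p * 2 ^ (⌈h / a⌉₊ + 4)

/-- The assumption at size parameter `m`, with exponents `a`, `h`, `p`, constant `C`,
bound `s` for the negligible part and index bound `Jp`. -/
structure SatisfiesAssumption (M : EigenModel Ω H) (P : Measure Ω)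
    (a h p C m s : ℝ) (Jp : ℕ+) : Prop where
  represented : M.IsRepresented P
  etaBar_bound : ∀ i j, ENNReal.ofReal (Real.sqrt m) *
    eLpNorm (M.etaBar P i j) (ENNReal.ofReal (momentOrder a h p)) P ≤ ENNReal.ofReal C
  etaR_bound : ∀ i j, ENNReal.ofReal (Real.sqrt m) *
    eLpNorm (M.etaR i j) (ENNReal.ofReal (momentOrder a h p)) P ≤ ENNReal.ofReal s
  gapSum_bound : ∀ j, j ≤ Jp →
    ENNReal.ofReal (m ^ (-(1 / 2 : ℝ) + a)) * M.gapSum j ≤ ENNReal.ofReal C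
  gapSumSq_bound : ∀ j, j ≤ Jp →
    ENNReal.ofReal (m ^ (-1 + 2 * a)) * M.gapSumSq j ≤ ENNReal.ofReal C
  lam_lower : m ^ (-h) / C ≤ M.lam Jp
  mean_lower : ∀ j, 1 / C ≤ ∫ ω, M.etaD j j ω ∂P
  mean_upper : ∀ j, ∫ ω, M.etaD j j ω ∂P ≤ C
  trace_bound : ∑' j, M.lam j ≤ C

end EigenModel

/-- `max_{1 ≤ j ≤ J} f j`. -/
noncomputable def maxUpTo (J : ℕ+) (f : ℕ+ → ℝ) : ℝ :=
  (Finset.Icc 1 J).sup' (Finset.nonempty_Icc.2 one_le) f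

/-! Fix `j`, write `u = m^(-1/2)`, `t = m^(-a)`, `σ = t + s`, and let `Δ` be the matrix of `Dhat -
D` in the system `e`. The perturbation is measured relative to the gaps of `lam j`: with `γ k = |lam
j - lam k|` for `k ≠ j` and `γ j` no larger than any gap, put `N = ∑ Δ k l ^ 2 / (γ k γ l)`. If `N ≤
1/64`, weighted Cauchy-Schwarz and the min-max principle locate the `j`-th eigenvalue of `Dhat`
within `√N γ j` of `lam j`. The eigenvector equation, read in coordinates, then shows that the
off-diagonal coordinates have small weighted norm, and substituting this back into each row yields
the first order expansions with quadratic remainders (`IsGapWeight.expansion`). A second weighted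
norm `B`, of order `Lambda j / m`, controls the eigenvector.

All randomness enters through one variable `G`, an `ℓ²` norm of the normalized scores. Its weights
(`scoreWeight`) dominate those of `N`, `B` and the Hilbert-Schmidt norm after normalization and have
bounded total mass, so by Jensen's inequality `G` inherits the moment of order `q`. The gap
assumptions give `N ≤ c (t G)^2`.

On the event `N > 1/64` no expansion is available, but there `X = 1 + G` satisfies `8 c t X ≥ 1`.
The factor `1 ≤ (8 c t X)^r` may then be inserted into crude bounds (Weyl's inequality, unit
vectors). With `r = 2𝔡 + 1` the power `t^r` is below `t` times the polynomial lower bounds for `lam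
j` and `Lambda j / m`, so the crude bounds also have the required rate (`exists_error_constant`).
Every realization thus obeys rate times `X^(2𝔡+5)`; since `p (2𝔡+5) ≤ q` this has bounded `L^p`
norm, and summing `p`-th powers over `j ≤ J` costs `J^(1/p)`. -/

section Variational

/-! ### Min-max bounds for ordered eigenvalues. -/

variable {H : Type*} [NormedAddCommGroup H] [InnerProductSpace ℝ H]

/-- A nonzero coefficient vector supported on `1, …, j` whose combination of the `u k` is orthogonal
to `w 1, …, w (j - 1)`. -/
lemma exists_coeff_orthogonal (u w : ℕ+ → H) (j : ℕ+) :
    ∃ a : ℕ+ → ℝ, (∃ k ∈ Finset.Iic j, a k ≠ 0) ∧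
      ∀ i, i < j → inner ℝ (w i) (∑ k ∈ Finset.Iic j, a k • u k) = 0 := by
  classical
  let f : (Finset.Iic j → ℝ) →ₗ[ℝ] (Finset.Iio j → ℝ) :=
    { toFun := fun a i => ∑ k, a k * inner ℝ (w i) (u k)
      map_add' := fun a b => by ext i; simp [add_mul, Finset.sum_add_distrib]
      map_smul' := fun c a => by ext i; simp [Finset.mul_sum, mul_assoc] }
  -- There are `j` unknowns and only `j - 1` conditions.
  have hf : f.ker ≠ ⊥ := by
    apply LinearMap.ker_ne_bot_of_finrank_lt
    rw [Module.finrank_fintype_fun_eq_card, Module.finrank_fintype_fun_eq_card]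
    simp only [Fintype.card_coe]
    apply Finset.card_lt_card
    rw [Finset.ssubset_iff_of_subset (fun x hx => by simp at hx ⊢; exact hx.le)]
    exact ⟨j, by simp, by simp⟩
  obtain ⟨a, ha, ha0⟩ := (Submodule.ne_bot_iff _).1 hf
  obtain ⟨k, hk⟩ := Function.ne_iff.1 ha0
  refine ⟨fun k => if hk : k ∈ Finset.Iic j then a ⟨k, hk⟩ else 0, ⟨k, k.2, by simpa using hk⟩, ?_⟩
  intro i hi
  have := congrFun (LinearMap.mem_ker.1 ha) ⟨i, by simpa using hi⟩
  simp only [f, LinearMap.coe_mk, AddHom.coe_mk, Pi.zero_apply] at this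
  rw [inner_sum, ← Finset.sum_coe_sort]
  refine Eq.trans ?_ this
  refine Finset.sum_congr rfl fun k _ => ?_
  simp only [inner_smul_right, dif_pos k.2]

lemma Orthonormal.norm_sq_sum {u : ℕ+ → H} (hu : Orthonormal ℝ u) (s : Finset ℕ+) (a : ℕ+ → ℝ) :
    ‖∑ k ∈ s, a k • u k‖ ^ 2 = ∑ k ∈ s, a k ^ 2 := by
  rw [← real_inner_self_eq_norm_sq, hu.inner_sum]
  simp [sq]

lemma Orthonormal.norm_sq_sum_pos {u : ℕ+ → H} (hu : Orthonormal ℝ u) {s : Finset ℕ+}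
    {a : ℕ+ → ℝ} (ha : ∃ k ∈ s, a k ≠ 0) : 0 < ‖∑ k ∈ s, a k • u k‖ ^ 2 := by
  obtain ⟨k, hk, hk0⟩ := ha
  rw [hu.norm_sq_sum]
  exact Finset.sum_pos' (fun _ _ => sq_nonneg _) ⟨k, hk, by positivity⟩

variable {T : H →L[ℝ] H} {μ : ℕ+ → ℝ} {v : ℕ+ → H}

/-- Upper bound for an ordered eigenvalue by the quadratic form on a subspace of codimension
`j - 1`. -/
lemma IsOrderedEigensystem.eigenvalue_le (h : IsOrderedEigensystem T μ v) (e : ℕ+ → H) (j : ℕ+)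
    (c : ℝ) (hc : ∀ x, (∀ i, i < j → inner ℝ (e i) x = 0) → inner ℝ (T x) x ≤ c * ‖x‖ ^ 2) :
    μ j ≤ c := by
  -- The test vector lies in the span of `v 1, …, v j`, where the Rayleigh quotient is at least `μ
  -- j`, and is orthogonal to `e 1, …, e (j - 1)`, where it is at most `c`. The lower bound below
  -- exchanges the roles of `e` and `v`.
  obtain ⟨a, ha, hort⟩ := exists_coeff_orthogonal v e j
  have hpos := h.orthonormal.norm_sq_sum_pos ha
  have h1 := hc _ hort
  have h2 : μ j * ‖∑ k ∈ Finset.Iic j, a k • v k‖ ^ 2 ≤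
      inner ℝ (T (∑ k ∈ Finset.Iic j, a k • v k)) (∑ k ∈ Finset.Iic j, a k • v k) := by
    have : T (∑ k ∈ Finset.Iic j, a k • v k) = ∑ k ∈ Finset.Iic j, (a k * μ k) • v k := by
      rw [map_sum]
      exact Finset.sum_congr rfl fun k _ => by rw [map_smul, h.eigen, smul_smul]
    rw [this, h.orthonormal.norm_sq_sum, h.orthonormal.inner_sum, Finset.mul_sum]
    refine Finset.sum_le_sum fun k hk => ?_
    have := h.antitone (Finset.mem_Iic.1 hk)
    simp only [conj_trivial]
    nlinarith [sq_nonneg (a k)]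
  nlinarith

/-- Lower bound for an ordered eigenvalue by the quadratic form on a subspace of dimension `j`. -/
lemma IsOrderedEigensystem.le_eigenvalue (h : IsOrderedEigensystem T μ v) {e : ℕ+ → H}
    (he : Orthonormal ℝ e) (j : ℕ+) (c : ℝ)
    (hc : ∀ x, (∀ i, j < i → inner ℝ (e i) x = 0) → ‖x‖ ^ 2 = ∑ i ∈ Finset.Iic j, inner ℝ (e i) x ^ 2
      → c * ‖x‖ ^ 2 ≤ inner ℝ (T x) x) :
    c ≤ μ j := by
  obtain ⟨a, ha, hort⟩ := exists_coeff_orthogonal e v j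
  have hpos := he.norm_sq_sum_pos ha
  have h1 := h.leading j _ hort
  have h2 := hc (∑ k ∈ Finset.Iic j, a k • e k) (fun i hi => by
    rw [inner_sum]
    refine Finset.sum_eq_zero fun k hk => ?_
    rw [inner_smul_right, he.2 (by have := Finset.mem_Iic.1 hk; exact (this.trans_lt hi).ne'),
      mul_zero]) (by
    rw [he.norm_sq_sum]
    exact Finset.sum_congr rfl fun i hi => by rw [he.inner_right_sum a hi])
  nlinarith

end Variational

/-! ### Cauchy-Schwarz for convergent series. -/

section Series

variable {ι : Type*}

lemma HasSum.of_forall_eq {f g : ι → ℝ} {s : ℝ} (hf : HasSum f s) (h : ∀ i, g i = f i) :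
    HasSum g s := by
  rwa [funext h]

/-- The Cauchy-Schwarz inequality for series. -/
lemma HasSum.sq_le_mul {a b c : ι → ℝ} {A B s : ℝ} (hs : HasSum c s)
    (ha : HasSum (fun i => a i ^ 2) A) (hb : HasSum (fun i => b i ^ 2) B)
    (hc : ∀ i, c i = a i * b i) : s ^ 2 ≤ A * B := by
  refine le_of_tendsto_of_tendsto (Tendsto.pow hs 2) (Tendsto.mul ha hb) (Eventually.of_forall fun t => ?_)
  simp only [hc]
  exact Finset.sum_mul_sq_le_sq_mul_sq t a b

end Series

/-! ### Perturbations given by matrix entries; weighted Weyl inequality. -/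

section Entries

variable {H : Type*} [NormedAddCommGroup H] [InnerProductSpace ℝ H]

/-- `D` has eigenvalues `lam` and eigenvectors `e`, and the entries of `Dh - D` in the system `e`
are `Δ`. -/
structure IsEntryPerturbation (D Dh : H →L[ℝ] H) (lam : ℕ+ → ℝ) (e : ℕ+ → H)
    (Δ : ℕ+ → ℕ+ → ℝ) : Prop where
  nonneg : ∀ j, 0 ≤ lam j
  antitone : Antitone lam
  orthonormal : Orthonormal ℝ e
  spectral : ∀ x, HasSum (fun j => (lam j * inner ℝ (e j) x) • e j) (D x)
  entries : ∀ x, HasSum (fun ij : ℕ+ × ℕ+ => (Δ ij.1 ij.2 * inner ℝ (e ij.1) x) • e ij.2)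
    (Dh x - D x)
  symm : ∀ i j, Δ i j = Δ j i

variable {D Dh : H →L[ℝ] H} {lam : ℕ+ → ℝ} {e : ℕ+ → H} {Δ : ℕ+ → ℕ+ → ℝ}

lemma HasSum.inner_right {ι : Type*} {f : ι → H} {s : H} (hf : HasSum f s) (y : H) :
    HasSum (fun i => inner ℝ y (f i)) (inner ℝ y s) :=
  (innerSL ℝ y).hasSum hf

lemma Orthonormal.inner_eq_of_hasSum (he : Orthonormal ℝ e) {c : ℕ+ → ℝ} {s : H}
    (hs : HasSum (fun k => c k • e k) s) (k : ℕ+) : inner ℝ (e k) s = c k := by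
  refine (hs.inner_right (e k)).unique ?_
  convert hasSum_single k ?_ using 1
  · simp [inner_smul_right, he.1]
  · intro l hl
    simp [inner_smul_right, he.2 hl.symm]

lemma Orthonormal.summable_inner_sq (he : Orthonormal ℝ e) (x : H) :
    Summable fun k => inner ℝ (e k) x ^ 2 := by
  simpa using he.inner_products_summable (x := x)

lemma Orthonormal.tsum_inner_sq_le (he : Orthonormal ℝ e) (x : H) :
    ∑' k, inner ℝ (e k) x ^ 2 ≤ ‖x‖ ^ 2 := by
  simpa using he.tsum_inner_products_le (x := x)

namespace IsEntryPerturbation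

lemma hasSum_inner_D (h : IsEntryPerturbation D Dh lam e Δ) (x : H) :
    HasSum (fun i => lam i * inner ℝ (e i) x ^ 2) (inner ℝ (D x) x) := by
  have := (h.spectral x).inner_right x
  simp only [inner_smul_right] at this
  rw [real_inner_comm]
  convert this using 2 with i
  rw [real_inner_comm (e _) x]; ring

lemma hasSum_inner_sub (h : IsEntryPerturbation D Dh lam e Δ) (x : H) :
    HasSum (fun ij : ℕ+ × ℕ+ => Δ ij.1 ij.2 * (inner ℝ (e ij.1) x * inner ℝ (e ij.2) x))
      (inner ℝ (Dh x - D x) x) := by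
  have := (h.entries x).inner_right x
  simp only [inner_smul_right] at this
  rw [real_inner_comm]
  convert this using 2 with i
  rw [real_inner_comm (e i.2) x]; ring

lemma hasSum_row (h : IsEntryPerturbation D Dh lam e Δ) (x : H) (k : ℕ+) :
    HasSum (fun i => Δ k i * inner ℝ (e i) x) (inner ℝ (e k) (Dh x - D x)) := by
  have := (h.entries x).inner_right (e k)
  simp only [inner_smul_right] at this
  have hinj : Function.Injective fun i : ℕ+ => (i, k) := fun a b hab => (Prod.ext_iff.1 hab).1
  rw [← hinj.hasSum_iff] at this
  · convert this using 2 with i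
    simp [h.symm k i, h.orthonormal.1]
  · rintro ⟨i, l⟩ hil
    have hl : k ≠ l := fun hkl => hil ⟨i, by simp [hkl]⟩
    simp [h.orthonormal.2 hl]

lemma inner_e_D (h : IsEntryPerturbation D Dh lam e Δ) (x : H) (k : ℕ+) :
    inner ℝ (e k) (D x) = lam k * inner ℝ (e k) x := by
  rw [h.orthonormal.inner_eq_of_hasSum (h.spectral x)]

/-- The weighted Hilbert-Schmidt bound for the quadratic form of the perturbation. -/
lemma abs_inner_sub_le (h : IsEntryPerturbation D Dh lam e Δ) {γ : ℕ+ → ℝ} (hγ : ∀ k, 0 < γ k)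
    {N Y : ℝ} (hN : HasSum (fun ij : ℕ+ × ℕ+ => Δ ij.1 ij.2 ^ 2 / (γ ij.1 * γ ij.2)) N) (x : H)
    (hY : HasSum (fun i => γ i * inner ℝ (e i) x ^ 2) Y) :
    |inner ℝ (Dh x - D x) x| ≤ √N * Y := by
  have hY0 : 0 ≤ Y := hY.nonneg fun i => mul_nonneg (hγ i).le (sq_nonneg _)
  have hN0 : 0 ≤ N := hN.nonneg fun i => div_nonneg (sq_nonneg _) (mul_pos (hγ _) (hγ _)).le
  have hYY : HasSum (fun ij : ℕ+ × ℕ+ =>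
      γ ij.1 * inner ℝ (e ij.1) x ^ 2 * (γ ij.2 * inner ℝ (e ij.2) x ^ 2)) (Y * Y) :=
    hY.mul hY (hY.summable.mul_of_nonneg hY.summable
      (fun i => mul_nonneg (hγ i).le (sq_nonneg _)) (fun i => mul_nonneg (hγ i).le (sq_nonneg _)))
  have key := (h.hasSum_inner_sub x).sq_le_mul
    (a := fun ij => Δ ij.1 ij.2 / √(γ ij.1 * γ ij.2))
    (b := fun ij => √(γ ij.1 * γ ij.2) * (inner ℝ (e ij.1) x * inner ℝ (e ij.2) x))
    (A := N) (B := Y * Y) ?_ ?_ ?_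
  · rw [← Real.sqrt_sq hY0, ← Real.sqrt_mul hN0, ← Real.sqrt_sq_eq_abs]
    exact Real.sqrt_le_sqrt (by rw [sq Y]; exact key)
  · convert hN using 2 with ij
    rw [div_pow, Real.sq_sqrt (mul_pos (hγ _) (hγ _)).le]
  · convert hYY using 2 with ij
    rw [mul_pow, Real.sq_sqrt (mul_pos (hγ _) (hγ _)).le]; ring
  · intro ij
    have : √(γ ij.1 * γ ij.2) ≠ 0 := (Real.sqrt_pos.2 (mul_pos (hγ _) (hγ _))).ne'
    field_simp

/-- Weighted form of Weyl's inequality. -/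
lemma abs_eigenvalue_sub_le (h : IsEntryPerturbation D Dh lam e Δ) {μ : ℕ+ → ℝ} {v : ℕ+ → H}
    (hs : IsOrderedEigensystem Dh μ v) {γ : ℕ+ → ℝ} (hγ : ∀ k, 0 < γ k) {Γ : ℝ}
    (hΓ : ∀ k, γ k ≤ Γ) {N : ℝ}
    (hN : HasSum (fun ij : ℕ+ × ℕ+ => Δ ij.1 ij.2 ^ 2 / (γ ij.1 * γ ij.2)) N) (j : ℕ+) {t : ℝ}
    (ht1 : ∀ i, j ≤ i → lam i + √N * γ i ≤ lam j + t)
    (ht2 : ∀ i, i ≤ j → lam j - t ≤ lam i - √N * γ i) :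
    |μ j - lam j| ≤ t := by
  have ht0 : 0 ≤ t := by
    have := ht1 j le_rfl
    have := mul_nonneg (Real.sqrt_nonneg N) (hγ j).le
    linarith
  have hsum : ∀ x : H, Summable fun i => γ i * inner ℝ (e i) x ^ 2 := fun x =>
    Summable.of_nonneg_of_le (fun i => mul_nonneg (hγ i).le (sq_nonneg _))
      (fun i => mul_le_mul_of_nonneg_right (hΓ i) (sq_nonneg _))
      ((h.orthonormal.summable_inner_sq x).mul_left Γ)
  have hsplit : ∀ x, inner ℝ (Dh x) x = inner ℝ (D x) x + inner ℝ (Dh x - D x) x := fun x => by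
    rw [← inner_add_left, add_sub_cancel]
  have hupper : μ j ≤ lam j + t := by
    refine hs.eigenvalue_le e j _ fun x hx => ?_
    have h1 := abs_le.1 (h.abs_inner_sub_le hγ hN x (hsum x).hasSum)
    have h2 := hasSum_le (fun i => ?_) ((h.hasSum_inner_D x).add ((hsum x).hasSum.mul_left √N))
      ((h.orthonormal.summable_inner_sq x).hasSum.mul_left (lam j + t))
    -- The system `e` need not span `H`, so only Bessel's inequality is available, and it requires
    -- `lam j + t ≥ 0`. In the lower bound the test vector lies in a finite span of `e`, so the sign
    -- of `lam j - t` is irrelevant.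
    · have h3 := mul_le_mul_of_nonneg_left (h.orthonormal.tsum_inner_sq_le x)
        (add_nonneg (h.nonneg j) ht0)
      rw [hsplit]
      linarith
    · rcases lt_or_ge i j with hij | hij
      · simp [hx i hij]
      · nlinarith [ht1 i hij, sq_nonneg (inner ℝ (e i) x)]
  have hlower : lam j - t ≤ μ j := by
    refine hs.le_eigenvalue h.orthonormal j _ fun x hx hxn => ?_
    have h1 := abs_le.1 (h.abs_inner_sub_le hγ hN x (hsum x).hasSum)
    have hx2 : HasSum (fun i => inner ℝ (e i) x ^ 2) (‖x‖ ^ 2) := by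
      rw [hxn]
      exact hasSum_sum_of_ne_finset_zero fun i hi => by
        rw [hx i (by simpa using hi)]; simp
    have h2 := hasSum_le (fun i => ?_) (hx2.mul_left (lam j - t))
      ((h.hasSum_inner_D x).sub ((hsum x).hasSum.mul_left √N))
    · rw [hsplit]
      linarith
    · rcases lt_or_ge j i with hij | hij
      · simp [hx i hij]
      · nlinarith [ht2 i hij, sq_nonneg (inner ℝ (e i) x)]
  exact abs_le.2 ⟨by linarith, by linarith⟩

/-- An eigenvector of `Dh` with nonzero eigenvalue lies in the closed span of `e`. -/
lemma hasSum_eigenvector [CompleteSpace H] (h : IsEntryPerturbation D Dh lam e Δ) {c : ℝ}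
    (hc : c ≠ 0) {x : H} (hx : Dh x = c • x) : HasSum (fun k => inner ℝ (e k) x • e k) x := by
  have hsm : Summable fun k => inner ℝ (e k) x • e k := by
    have := (h.orthonormal.orthogonalFamily.summable_iff_norm_sq_summable
      (fun k => inner ℝ (e k) x)).2 (by simpa using h.orthonormal.summable_inner_sq x)
    simpa using this
  obtain ⟨s, hs⟩ := hsm
  have hort : ∀ k, inner ℝ (e k) (x - s) = 0 := by
    intro k
    rw [inner_sub_right, h.orthonormal.inner_eq_of_hasSum hs, sub_self]
  have hort' : ∀ k, inner ℝ (x - s) (e k) = 0 := fun k => by rw [real_inner_comm, hort]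
  -- A vector orthogonal to every `e k` is orthogonal to the ranges of `D` and `Dh - D`. Since `Dh x
  -- = c • x` with `c ≠ 0`, the residual `x - s` is orthogonal to `x` as well, hence to itself.
  have h0 : inner ℝ (x - s) (Dh x) = 0 := by
    have h1 := (h.entries x).inner_right (x - s)
    have h2 := (h.spectral x).inner_right (x - s)
    simp only [inner_smul_right, hort', mul_zero] at h1 h2
    have h1' := h1.unique hasSum_zero
    have h2' := h2.unique hasSum_zero
    have h3 : Dh x = (Dh x - D x) + D x := by abel
    rw [h3, inner_add_right, h1', h2', add_zero]
  rw [hx, inner_smul_right] at h0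
  have h1 : inner ℝ (x - s) x = 0 := by simpa [hc] using h0
  have h2 : inner ℝ (x - s) s = 0 := by
    have := hs.inner_right (x - s)
    simp only [inner_smul_right, hort', mul_zero] at this
    exact this.unique hasSum_zero
  have h3 : x - s = 0 := by
    rw [← inner_self_eq_zero (𝕜 := ℝ), inner_sub_right, h1, h2, sub_self]
  rwa [← sub_eq_zero.1 h3] at hs

end IsEntryPerturbation

end Entries

/-! ### First order expansions for a small relative perturbation. -/

section GoodEvent

lemma hasSum_ne_iff {ι : Type*} [DecidableEq ι] {f : ι → ℝ} {j : ι} {s : ℝ} :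
    HasSum (fun k : {k // k ≠ j} => f k) s ↔ HasSum f (s + f j) := by
  have := Finset.hasSum_compl_iff (f := f) (a := s) {j}
  simp only [Finset.sum_singleton] at this
  rw [← this]
  exact (Equiv.hasSum_iff (Equiv.subtypeEquivRight fun x => by simp :
    {x // x ∉ ({j} : Finset ι)} ≃ {k // k ≠ j}) (f := fun k : {k // k ≠ j} => f k)).symm

/-- Weights adapted to the gaps of the eigenvalue `lam j`. -/
structure IsGapWeight (lam γ : ℕ+ → ℝ) (j : ℕ+) : Prop where
  pos : 0 < γ j
  eq_gap : ∀ k, k ≠ j → γ k = |lam j - lam k|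
  le_all : ∀ k, γ j ≤ γ k
  le_lam : γ j ≤ lam j

set_option maxHeartbeats 1000000 in
/-- First order expansions of the solution of the eigenvalue equation in coordinates. -/
lemma IsGapWeight.expansion {lam γ x : ℕ+ → ℝ} {Δ : ℕ+ → ℕ+ → ℝ} {j : ℕ+} {m Γ N B : ℝ}
    (hγ : IsGapWeight lam γ j) (hΓ : ∀ k, γ k ≤ Γ)
    (hN : HasSum (fun ij : ℕ+ × ℕ+ => Δ ij.1 ij.2 ^ 2 / (γ ij.1 * γ ij.2)) N)
    (hB : HasSum (fun ij : ℕ+ × ℕ+ => (if ij.1 = j then 0 else γ j / γ ij.1 ^ 2) *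
      (Δ ij.1 ij.2 ^ 2 / γ ij.2)) B)
    (hN1 : N ≤ 1 / 64) (hD0 : |m - lam j| ≤ √N * γ j)
    (hx1 : HasSum (fun k => x k ^ 2) 1) (hxj0 : 0 ≤ x j)
    (hrow : ∀ k, HasSum (fun l => Δ k l * x l) ((m - lam k) * x k)) :
    |m - lam j - Δ j j| ≤ 2 * (γ j * N) ∧
    1 - x j ^ 2 ≤ 2 * B ∧
    (∑' k : {k // k ≠ j}, (x k - Δ k j / (lam j - lam k)) ^ 2) ≤
      10 * (N * B) + 6 * B ^ 2 := by
  have hpos : ∀ k, 0 < γ k := fun k => hγ.pos.trans_le (hγ.le_all k)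
  have hg0 : 0 < γ j := hγ.pos
  generalize hg : γ j = g at *
  have hN0 : 0 ≤ N := hN.nonneg fun i => div_nonneg (sq_nonneg _) (mul_pos (hpos _) (hpos _)).le
  have hβ0 : ∀ k, 0 ≤ (if k = j then 0 else g / γ k ^ 2) := fun k => by
    split_ifs
    · exact le_rfl
    · exact div_nonneg hg0.le (sq_nonneg _)
  have hle_all : ∀ k, g ≤ γ k := fun k => hg ▸ hγ.le_all k
  have hsN : √N ≤ 1 / 8 := by
    rw [Real.sqrt_le_left (by norm_num)]; linarith
  have hD0' : |m - lam j| ≤ g / 8 := hD0.trans (by nlinarith)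
  have hD0sq : (lam j - m) ^ 2 ≤ N * g ^ 2 := by
    rw [← Real.sq_sqrt hN0, ← mul_pow, ← sq_abs, abs_sub_comm]
    exact pow_le_pow_left₀ (abs_nonneg _) hD0 2
  have hxY : Summable fun k => γ k * x k ^ 2 :=
    Summable.of_nonneg_of_le (fun i => mul_nonneg (hpos i).le (sq_nonneg _))
      (fun i => mul_le_mul_of_nonneg_right (hΓ i) (sq_nonneg _)) (hx1.summable.mul_left Γ)
  obtain ⟨Y, hY⟩ := hxY
  have hYg : g ≤ Y := by
    have := hasSum_le (fun k => mul_le_mul_of_nonneg_right (hle_all k) (sq_nonneg (x k)))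
      (hx1.mul_left g) hY
    linarith
  have hY' : HasSum (fun k => γ k * (if k = j then 0 else x k) ^ 2) (Y - g * x j ^ 2) := by
    rw [← hg]
    refine HasSum.of_forall_eq (hasSum_ite_sub_hasSum hY j) fun k => ?_
    split_ifs <;> simp
  obtain ⟨Y', hY'def⟩ : ∃ Y', Y' = Y - g * x j ^ 2 := ⟨_, rfl⟩
  rw [← hY'def] at hY'
  -- rows of the perturbation
  have hTs : ∀ k, Summable fun l => Δ k l ^ 2 / γ l := fun k => by
    have := (hN.summable.prod_factor k).mul_left (γ k)
    refine this.congr fun l => ?_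
    have := (hpos k).ne'
    have := (hpos l).ne'
    field_simp
  -- `T k` is the weighted squared norm of row `k`; weighted sums of the `T k` recover both `N` and
  -- `B`, so the double sums are only used through rows.
  choose T hT using hTs
  have hT0 : ∀ k, 0 ≤ T k := fun k =>
    (hT k).nonneg fun l => div_nonneg (sq_nonneg _) (hpos l).le
  have hTN : HasSum (fun k => T k / γ k) N := by
    refine hN.prod_fiberwise fun k => ?_
    refine HasSum.of_forall_eq ((hT k).div_const (γ k)) fun l => ?_
    rw [div_div, mul_comm]
  have hTB : HasSum (fun k => (if k = j then 0 else g / γ k ^ 2) * T k) B :=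
    hB.prod_fiberwise fun k => (hT k).mul_left _
  have hB0 : 0 ≤ B := hTB.nonneg fun k => mul_nonneg (hβ0 k) (hT0 k)
  have hcs : ∀ k (y : ℕ+ → ℝ) (r Z : ℝ), HasSum (fun l => Δ k l * y l) r →
      HasSum (fun l => γ l * y l ^ 2) Z → r ^ 2 ≤ T k * Z := by
    intro k y r Z hr hZ
    refine hr.sq_le_mul (a := fun l => Δ k l / √(γ l)) (b := fun l => √(γ l) * y l) ?_ ?_ ?_
    · convert hT k using 2 with l
      rw [div_pow, Real.sq_sqrt (hpos l).le]
    · convert hZ using 2 with l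
      rw [mul_pow, Real.sq_sqrt (hpos l).le]
    · intro l
      have : √(γ l) ≠ 0 := (Real.sqrt_pos.2 (hpos l)).ne'
      field_simp
  have hrow' : ∀ k, HasSum (fun l => Δ k l * (if l = j then 0 else x l))
      ((m - lam k) * x k - Δ k j * x j) := by
    intro k
    refine HasSum.of_forall_eq (hasSum_ite_sub_hasSum (hrow k) j) fun l => ?_
    split_ifs <;> simp
  have hR : ∀ k, ((m - lam k) * x k) ^ 2 ≤ T k * Y := fun k => hcs k _ _ _ (hrow k) hY
  have hR' : ∀ k, ((m - lam k) * x k - Δ k j * x j) ^ 2 ≤ T k * Y' :=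
    fun k => hcs k _ _ _ (hrow' k) hY'
  -- Moving `lam j` to `m` costs at most `γ j / 8 ≤ γ k / 8`, so the perturbed gaps are still at
  -- least `7/8` of the original ones.
  have hgap : ∀ k, k ≠ j → 49 / 64 * γ k ^ 2 ≤ (m - lam k) ^ 2 := by
    intro k hk
    have h1 := hle_all k
    have h2 : γ k ≤ |m - lam k| + g / 8 := by
      rw [hγ.eq_gap k hk]
      calc |lam j - lam k| = |(m - lam k) - (m - lam j)| := by congr 1; ring
        _ ≤ _ := (abs_sub _ _).trans (by linarith)
    have h3 : 7 / 8 * γ k ≤ |m - lam k| := by linarith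
    rw [← sq_abs (m - lam k)]
    nlinarith [hpos k]
  have hxk : ∀ k, k ≠ j → γ k ^ 2 * x k ^ 2 ≤ 64 / 49 * (T k * Y) := by
    intro k hk
    have h1 := hR k
    have h2 := mul_le_mul_of_nonneg_right (hgap k hk) (sq_nonneg (x k))
    rw [mul_pow] at h1
    linarith
  -- the weighted norm off the diagonal
  have hY'0 : 0 ≤ Y' := hY'.nonneg fun k => mul_nonneg (hpos k).le (sq_nonneg _)
  have hY'N : Y' ≤ 64 / 49 * (N * Y) := by
    have := hasSum_le (fun k => ?_) hY' ((hTN.mul_right Y).mul_left (64 / 49))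
    · linarith
    · split_ifs with hk
      · have := hT0 k
        have := hpos k
        have : 0 ≤ Y := hg0.le.trans hYg
        simp only [ne_eq, OfNat.ofNat_ne_zero, not_false_eq_true, zero_pow, mul_zero]
        positivity
      · have h1 := hxk k hk
        have h2 := hpos k
        rw [← mul_le_mul_iff_right₀ h2]
        calc γ k * (γ k * x k ^ 2) = γ k ^ 2 * x k ^ 2 := by ring
          _ ≤ _ := h1
          _ = _ := by field_simp
  have hY0 : 0 < Y := hg0.trans_le hYg
  -- The estimate closes on itself: the off-diagonal part `Y'` is at most `64/49 * N * Y ≤ Y / 49`,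
  -- so the diagonal term carries almost all of `Y`. Reinserting this makes `Y'` of size `N * g`,
  -- and forces `x j ≠ 0`.
  have hYle : Y ≤ 49 / 48 * (g * x j ^ 2) := by
    have : N * Y ≤ 1 / 64 * Y := mul_le_mul_of_nonneg_right hN1 hY0.le
    linarith
  have hY'le : Y' ≤ 4 / 3 * (N * (g * x j ^ 2)) := by
    have : N * Y ≤ N * (49 / 48 * (g * x j ^ 2)) := mul_le_mul_of_nonneg_left hYle hN0
    linarith
  have hxj1 : x j ^ 2 ≤ 1 := le_hasSum hx1 j fun k _ => sq_nonneg _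
  have hxjle : x j ≤ 1 := by nlinarith
  have hxjpos : 0 < x j ^ 2 := by
    by_contra hcon
    nlinarith [sq_nonneg (x j)]
  have hTj : T j ≤ N * g := by
    have := le_hasSum hTN j fun k _ => div_nonneg (hT0 k) (hpos k).le
    rwa [hg, div_le_iff₀ hg0] at this
  have hΔT : ∀ k, Δ k j ^ 2 ≤ g * T k := by
    intro k
    have := le_hasSum (hT k) j fun l _ => div_nonneg (sq_nonneg _) (hpos l).le
    rw [hg] at this
    rwa [div_le_iff₀ hg0, mul_comm] at this
  have hTB' : HasSum (fun k : {k // k ≠ j} => g / γ k ^ 2 * T k) B := by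
    have := (hasSum_ne_iff (f := fun k => (if k = j then 0 else g / γ k ^ 2) * T k) (j := j)
      (s := B)).2 (by simpa using hTB)
    convert this using 2 with k
    rw [if_neg k.2]
  have hx1' : HasSum (fun k : {k // k ≠ j} => x k ^ 2) (1 - x j ^ 2) :=
    (hasSum_ne_iff (f := fun k => x k ^ 2) (j := j)).2 (by simpa using hx1)
  have hgabs : ∀ k : {k // k ≠ j}, (lam j - lam k) ^ 2 = γ k ^ 2 := fun k => by
    rw [hγ.eq_gap k k.2, sq_abs]
  have hz : 1 - x j ^ 2 ≤ 4 / 3 * B := by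
    refine hasSum_le (fun k => ?_) hx1' (hTB'.mul_left (4 / 3))
    have h1 := hxk k k.2
    have h2 := pow_pos (hpos k) 2
    have h3 : T k * Y ≤ T k * (49 / 48 * g) :=
      mul_le_mul_of_nonneg_left (hYle.trans (by nlinarith)) (hT0 k)
    rw [← mul_le_mul_iff_right₀ h2]
    calc γ k ^ 2 * x k ^ 2 ≤ 4 / 3 * (g * T k) := by linarith
      _ = _ := by have := (hpos k).ne'; field_simp
  -- The remainder times the gap splits into three second order pieces: the eigenvalue shift acting
  -- on `x k`, the defect `1 - x j` in column `j`, and the rest of row `k` applied to the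
  -- off-diagonal coordinates.
  have hu : ∀ k : {k // k ≠ j}, (x k - Δ k j / (lam j - lam k)) ^ 2 ≤
      3 * (N * x k ^ 2 + (g / γ k ^ 2 * T k) * (1 - x j) ^ 2 +
        4 / 3 * (N * (g / γ k ^ 2 * T k))) := by
    intro k
    have hd : lam j - lam k ≠ 0 := by
      have := pow_pos (hpos k) 2
      rw [← hgabs k] at this
      exact fun h0 => by simp [h0] at this
    have h2 := pow_pos (hpos k) 2
    have h3 : x k - Δ k j / (lam j - lam k) = ((lam j - m) * x k - Δ k j * (1 - x j) +
        ((m - lam k) * x k - Δ k j * x j)) / (lam j - lam k) := by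
      field_simp; ring
    have h4 : γ k ^ 2 * (g / γ k ^ 2 * T k) = g * T k := by
      have := (hpos k).ne'
      field_simp
    rw [h3, div_pow, hgabs, div_le_iff₀ h2]
    have h5 : ∀ a b c : ℝ, (a - b + c) ^ 2 ≤ 3 * (a ^ 2 + b ^ 2 + c ^ 2) := fun a b c => by
      nlinarith [sq_nonneg (a + b), sq_nonneg (a - c), sq_nonneg (b + c)]
    refine (h5 _ _ _).trans ?_
    have h6 : ((lam j - m) * x k) ^ 2 ≤ N * γ k ^ 2 * x k ^ 2 := by
      rw [mul_pow]
      refine mul_le_mul_of_nonneg_right (hD0sq.trans ?_) (sq_nonneg _)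
      exact mul_le_mul_of_nonneg_left (pow_le_pow_left₀ hg0.le (hle_all k) 2) hN0
    have h7 : (Δ k j * (1 - x j)) ^ 2 ≤ g * T k * (1 - x j) ^ 2 := by
      rw [mul_pow]
      exact mul_le_mul_of_nonneg_right (hΔT k) (sq_nonneg _)
    have h8 : ((m - lam k) * x k - Δ k j * x j) ^ 2 ≤ T k * (4 / 3 * (N * g)) := by
      refine (hR' k).trans (mul_le_mul_of_nonneg_left (hY'le.trans ?_) (hT0 k))
      have : g * x j ^ 2 ≤ g := by nlinarith
      linarith [mul_le_mul_of_nonneg_left this hN0]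
    calc _ ≤ 3 * (N * γ k ^ 2 * x k ^ 2 + g * T k * (1 - x j) ^ 2 + T k * (4 / 3 * (N * g))) := by
          linarith
      _ = 3 * (N * γ k ^ 2 * x k ^ 2 + (γ k ^ 2 * (g / γ k ^ 2 * T k)) * (1 - x j) ^ 2 +
        4 / 3 * (N * (γ k ^ 2 * (g / γ k ^ 2 * T k)))) := by rw [h4]; ring
      _ = _ := by ring
  refine ⟨?_, by linarith, ?_⟩
  · have h1 := hR' j
    have h2 : ((m - lam j) * x j - Δ j j * x j) ^ 2 =
        (m - lam j - Δ j j) ^ 2 * x j ^ 2 := by ring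
    rw [h2] at h1
    have h3 : T j * Y' ≤ (N * g) * (4 / 3 * (N * (g * x j ^ 2))) :=
      mul_le_mul hTj hY'le hY'0 (mul_nonneg hN0 hg0.le)
    -- Both sides of row `j` carry the factor `x j ^ 2`, which cancels.
    have h4 : (m - lam j - Δ j j) ^ 2 ≤ 4 / 3 * (g * N) ^ 2 := by
      refine le_of_mul_le_mul_right ?_ hxjpos
      calc _ ≤ _ := h1.trans h3
        _ = _ := by ring
    refine abs_le_of_sq_le_sq (h4.trans ?_) (by positivity)
    nlinarith [sq_nonneg (g * N)]
  · have hsum := (((hx1'.mul_left N).add (hTB'.mul_right ((1 - x j) ^ 2))).add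
      ((hTB'.mul_left N).mul_left (4 / 3))).mul_left 3
    refine ((Summable.of_nonneg_of_le (fun _ => sq_nonneg _) hu hsum.summable).tsum_le_tsum hu
      hsum.summable).trans ?_
    rw [hsum.tsum_eq]
    have h1 : (1 - x j) ^ 2 ≤ 4 / 3 * B := by nlinarith
    have h2 := mul_le_mul_of_nonneg_left h1 hB0
    have h3 := mul_le_mul_of_nonneg_left hz hN0
    nlinarith [mul_nonneg hN0 hB0]

variable {H : Type*} [NormedAddCommGroup H] [InnerProductSpace ℝ H] [CompleteSpace H]
variable {D Dh : H →L[ℝ] H} {lam : ℕ+ → ℝ} {e : ℕ+ → H} {Δ : ℕ+ → ℕ+ → ℝ}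

/-- First order expansions of an eigenvalue and an eigenvector of `Dh`, when the weighted
Hilbert-Schmidt norm of the perturbation is small. -/
theorem IsEntryPerturbation.expansion (h : IsEntryPerturbation D Dh lam e Δ) {μ : ℕ+ → ℝ}
    {v : ℕ+ → H} (hs : IsOrderedEigensystem Dh μ v) {j : ℕ+} {γ : ℕ+ → ℝ}
    (hγ : IsGapWeight lam γ j) {N B : ℝ}
    (hN : HasSum (fun ij : ℕ+ × ℕ+ => Δ ij.1 ij.2 ^ 2 / (γ ij.1 * γ ij.2)) N)
    (hB : HasSum (fun ij : ℕ+ × ℕ+ => (if ij.1 = j then 0 else γ j / γ ij.1 ^ 2) *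
      (Δ ij.1 ij.2 ^ 2 / γ ij.2)) B)
    (hN1 : N ≤ 1 / 64) (hsign : 0 ≤ inner ℝ (v j) (e j)) :
    |μ j - lam j - Δ j j| ≤ 2 * (γ j * N) ∧
    HasSum (fun k => inner ℝ (e k) (v j) • e k) (v j) ∧
    1 - inner ℝ (e j) (v j) ^ 2 ≤ 2 * B ∧
    (∑' k : {k // k ≠ j}, (inner ℝ (e k) (v j) - Δ k j / (lam j - lam k)) ^ 2) ≤
      10 * (N * B) + 6 * B ^ 2 := by
  have hpos : ∀ k, 0 < γ k := fun k => hγ.pos.trans_le (hγ.le_all k)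
  have hg0 : 0 < γ j := hγ.pos
  have hΓ : ∀ k, γ k ≤ lam 1 := by
    intro k
    have h1 := h.antitone (one_le : 1 ≤ j)
    by_cases hk : k = j
    · rw [hk]; exact hγ.le_lam.trans h1
    · have h2 := h.antitone (one_le : 1 ≤ k)
      rw [hγ.eq_gap k hk, abs_le]
      constructor <;> linarith [h.nonneg k, h.nonneg j]
  -- location of the eigenvalue
  have hsN : √N ≤ 1 / 8 := by
    rw [Real.sqrt_le_left (by norm_num)]; linarith
  have hsN0 := Real.sqrt_nonneg N
  have hD0 : |μ j - lam j| ≤ √N * γ j := by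
    refine h.abs_eigenvalue_sub_le hs hpos hΓ hN j ?_ ?_
    · intro i hi
      by_cases hij : i = j
      · rw [hij]
      · have h1 := h.antitone hi
        rw [hγ.eq_gap i hij, abs_of_nonneg (by linarith)]
        nlinarith [mul_nonneg hsN0 hg0.le]
    · intro i hi
      by_cases hij : i = j
      · rw [hij]
      · have h1 := h.antitone hi
        rw [hγ.eq_gap i hij, abs_of_nonpos (by linarith)]
        nlinarith [mul_nonneg hsN0 hg0.le]
  have hD0' : |μ j - lam j| ≤ γ j / 8 := hD0.trans (by nlinarith)
  have hμ0 : μ j ≠ 0 := by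
    have := (abs_le.1 hD0').1
    have := hγ.le_lam
    have : 0 < μ j := by linarith
    exact this.ne'
  -- coordinates of the eigenvector
  have hexp := h.hasSum_eigenvector hμ0 (hs.eigen j)
  have hxj0 : 0 ≤ inner ℝ (e j) (v j) := by simpa [real_inner_comm] using hsign
  have hx1 : HasSum (fun k => inner ℝ (e k) (v j) ^ 2) 1 := by
    have := hexp.inner_right (v j)
    rw [real_inner_self_eq_norm_sq, hs.orthonormal.1, one_pow] at this
    refine HasSum.of_forall_eq this fun k => ?_
    rw [inner_smul_right, real_inner_comm (e k) (v j), sq]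
  obtain ⟨h1, h2, h3⟩ := hγ.expansion hΓ hN hB hN1 hD0 hx1 hxj0 fun k => by
    convert h.hasSum_row (v j) k using 1
    rw [inner_sub_right, hs.eigen, inner_smul_right, h.inner_e_D]
    ring
  exact ⟨h1, hexp, h2, h3⟩

end GoodEvent

/-! ### Eigenvector errors and the combination of the two cases. -/

section Vectors

/-- The squared first order coefficients are exactly the column `j` of the double series for `B`:
there the factor `γ j` cancels. -/
lemma IsGapWeight.summable_first_order {lam γ : ℕ+ → ℝ} {Δ : ℕ+ → ℕ+ → ℝ} {j : ℕ+} {B : ℝ}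
    (hγ : IsGapWeight lam γ j)
    (hB : HasSum (fun ij : ℕ+ × ℕ+ => (if ij.1 = j then 0 else γ j / γ ij.1 ^ 2) *
      (Δ ij.1 ij.2 ^ 2 / γ ij.2)) B) :
    (Summable fun k : {k // k ≠ j} => (Δ k j / (lam j - lam k)) ^ 2) ∧
    (∑' k : {k // k ≠ j}, (Δ k j / (lam j - lam k)) ^ 2) ≤ B := by
  have hpos : ∀ k, 0 < γ k := fun k => hγ.pos.trans_le (hγ.le_all k)
  have hinj : Function.Injective fun k : {k : ℕ+ // k ≠ j} => ((k : ℕ+), j) :=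
    fun a b hab => Subtype.ext (Prod.ext_iff.1 hab).1
  have heq : ∀ k : {k // k ≠ j}, (Δ k j / (lam j - lam k)) ^ 2 =
      (if (k : ℕ+) = j then 0 else γ j / γ k ^ 2) * (Δ k j ^ 2 / γ j) := by
    intro k
    have h1 := (hpos k).ne'
    have h2 := (hpos j).ne'
    rw [if_neg k.2, div_pow, ← sq_abs (lam j - lam k), ← hγ.eq_gap k k.2]
    field_simp
  have hs := hB.summable.comp_injective hinj
  have hs' : Summable fun k : {k // k ≠ j} => (Δ k j / (lam j - lam k)) ^ 2 :=
    hs.congr fun k => (heq k).symm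
  refine ⟨hs', ?_⟩
  refine (hs'.tsum_le_tsum_of_inj _ hinj (fun ij _ => ?_) (fun k => (heq k).le) hB.summable).trans_eq
    hB.tsum_eq
  refine mul_nonneg ?_ (div_nonneg (sq_nonneg _) (hpos _).le)
  split_ifs
  · exact le_rfl
  · exact div_nonneg hγ.pos.le (sq_nonneg _)

variable {H : Type*} [NormedAddCommGroup H] [InnerProductSpace ℝ H]

lemma Orthonormal.summable_smul_iff [CompleteSpace H] {ι : Type*} {e : ι → H} (he : Orthonormal ℝ e) (c : ι → ℝ) :
    (Summable fun k => c k • e k) ↔ Summable fun k => c k ^ 2 := by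
  have := he.orthogonalFamily.summable_iff_norm_sq_summable c
  simpa using this

lemma Orthonormal.norm_sq_of_hasSum {ι : Type*} {e : ι → H} (he : Orthonormal ℝ e) {c : ι → ℝ}
    {x : H} (hx : HasSum (fun k => c k • e k) x) : HasSum (fun k => c k ^ 2) (‖x‖ ^ 2) := by
  have h1 := hx.inner_right x
  rw [real_inner_self_eq_norm_sq] at h1
  refine HasSum.of_forall_eq h1 fun k => ?_
  have h2 : inner ℝ (e k) x = c k := by
    classical
    refine (hx.inner_right (e k)).unique ?_
    convert hasSum_single k ?_ using 1
    · simp [inner_smul_right, he.1]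
    · intro l hl
      simp [inner_smul_right, he.2 hl.symm]
  rw [inner_smul_right, real_inner_comm, h2, sq]

variable [CompleteSpace H]

/-- The centered eigenvector error in terms of first order coefficients `f`. -/
lemma Orthonormal.eigenvector_error {e : ℕ+ → H} (he : Orthonormal ℝ e) {w : H} (hw : ‖w‖ = 1)
    {j : ℕ+} (hsign : 0 ≤ inner ℝ w (e j)) {f : {k // k ≠ j} → ℝ}
    (hf : Summable fun k => f k ^ 2) :
    ‖w - e j + (‖w - e j‖ ^ 2 / 2) • e j - ∑' k : {k // k ≠ j}, f k • e k‖ ≤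
        1 + √(∑' k, f k ^ 2) ∧
      |‖w - e j‖ ^ 2 - ∑' k, f k ^ 2| ≤ 2 + ∑' k, f k ^ 2 ∧
      (HasSum (fun k => inner ℝ (e k) w • e k) w →
        ‖w - e j + (‖w - e j‖ ^ 2 / 2) • e j - ∑' k : {k // k ≠ j}, f k • e k‖ ^ 2 =
          ∑' k : {k // k ≠ j}, (inner ℝ (e k) w - f k) ^ 2 ∧
        |‖w - e j‖ ^ 2 - ∑' k, f k ^ 2| ≤ (1 - inner ℝ (e j) w ^ 2) ^ 2 +
          ‖w - e j + (‖w - e j‖ ^ 2 / 2) • e j - ∑' k : {k // k ≠ j}, f k • e k‖ *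
            (√(1 - inner ℝ (e j) w ^ 2) + √(∑' k, f k ^ 2))) := by
  have he' : Orthonormal ℝ fun k : {k // k ≠ j} => e k :=
    he.comp _ Subtype.val_injective
  obtain ⟨F, hF⟩ := (he'.summable_smul_iff f).2 hf
  have hF2 := he'.norm_sq_of_hasSum hF
  rw [hF.tsum_eq, hF2.tsum_eq, Real.sqrt_sq (norm_nonneg _)]
  set x : ℝ := inner ℝ (e j) w with hx
  have hx0 : 0 ≤ x := by rw [hx, real_inner_comm]; exact hsign
  have hdist : ‖w - e j‖ ^ 2 = 2 - 2 * x := by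
    rw [norm_sub_sq_real, hw, he.1 j, real_inner_comm]; ring
  -- The quadratic correction removes the whole `e j`-component of the error, because `‖w - e j‖ ^ 2
  -- / 2 = 1 - x` for unit vectors. What remains is the part of `w` orthogonal to `e j`.
  have hvec : w - e j + (‖w - e j‖ ^ 2 / 2) • e j = w - x • e j := by
    rw [hdist]; module
  have hz : ‖w - x • e j‖ ^ 2 = 1 - x ^ 2 := by
    rw [norm_sub_sq_real, hw, norm_smul, he.1 j, inner_smul_right, real_inner_comm, ← hx,
      mul_one, Real.norm_eq_abs, sq_abs]; ring
  have hz1 : ‖w - x • e j‖ ≤ 1 := by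
    refine abs_le_of_sq_le_sq' (by rw [hz]; nlinarith) zero_le_one |>.2
  have hx1 : x ≤ 1 := by nlinarith [sq_nonneg ‖w - x • e j‖]
  rw [hvec]
  refine ⟨(norm_sub_le _ _).trans (by linarith), ?_, fun hexp => ⟨?_, ?_⟩⟩
  · rw [hdist, abs_le]
    constructor <;> nlinarith [sq_nonneg ‖F‖]
  · have h1 : HasSum (fun k : {k // k ≠ j} => inner ℝ (e k) w • e k) (w - x • e j) := by
      have h2 := hasSum_ite_sub_hasSum hexp j
      rw [← hx] at h2
      have h3 := (Subtype.val_injective (p := fun k : ℕ+ => k ≠ j)).hasSum_iff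
        (f := fun n => if n = j then 0 else inner ℝ (e n) w • e n) (a := w - x • e j)
        (fun k hk => by simp at hk; simp [hk])
      rw [← h3] at h2
      convert h2 using 2 with k
      simp [k.2]
    have h2 := he'.norm_sq_of_hasSum (c := fun k => inner ℝ (e k) w - f k)
      (x := w - x • e j - F) (by simpa [sub_smul] using h1.sub hF)
    exact h2.tsum_eq.symm
  · have h1 : |‖w - x • e j‖ - ‖F‖| ≤ ‖w - x • e j - F‖ := abs_norm_sub_norm_le _ _
    have h2 : √(1 - x ^ 2) = ‖w - x • e j‖ := by rw [← hz, Real.sqrt_sq (norm_nonneg _)]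
    rw [h2, ← hz]
    have h3 : ‖w - e j‖ ^ 2 - ‖F‖ ^ 2 = (1 - x) ^ 2 +
        (‖w - x • e j‖ - ‖F‖) * (‖w - x • e j‖ + ‖F‖) := by
      rw [hdist]
      linear_combination -hz
    rw [h3]
    refine (abs_add_le _ _).trans (add_le_add ?_ ?_)
    · rw [hz, abs_of_nonneg (sq_nonneg _)]
      exact pow_le_pow_left₀ (by linarith) (by nlinarith) 2
    · rw [abs_mul, abs_of_nonneg (add_nonneg (norm_nonneg (w - x • e j)) (norm_nonneg F))]
      exact mul_le_mul_of_nonneg_right h1 (by positivity)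

/-- Deterministic bounds for the errors of the first order expansions, when the perturbation is the
difference of a contributing part `S` and a negligible part `R`. -/
theorem IsEntryPerturbation.error_bounds {D Dh : H →L[ℝ] H} {lam : ℕ+ → ℝ} {e : ℕ+ → H}
    {S R : ℕ+ → ℕ+ → ℝ} (h : IsEntryPerturbation D Dh lam e fun i k => S i k - R i k)
    {μ : ℕ+ → ℝ} {v : ℕ+ → H} (hs : IsOrderedEigensystem Dh μ v) {j : ℕ+} {γ : ℕ+ → ℝ}
    (hγ : IsGapWeight lam γ j) {N B A Q : ℝ}
    (hN : HasSum (fun ij : ℕ+ × ℕ+ => (S ij.1 ij.2 - R ij.1 ij.2) ^ 2 / (γ ij.1 * γ ij.2)) N)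
    (hB : HasSum (fun ij : ℕ+ × ℕ+ => (if ij.1 = j then 0 else γ j / γ ij.1 ^ 2) *
      ((S ij.1 ij.2 - R ij.1 ij.2) ^ 2 / γ ij.2)) B)
    (hA : HasSum (fun k : {k // k ≠ j} => (R k j / (lam j - lam k)) ^ 2) A)
    (hQ : HasSum (fun ij : ℕ+ × ℕ+ => (S ij.1 ij.2 - R ij.1 ij.2) ^ 2) Q)
    (hsign : 0 ≤ inner ℝ (v j) (e j)) {e1 e2 e3 F : ℝ}
    (he1 : e1 = |μ j - lam j - S j j|)
    (he2 : e2 = ‖v j - e j + (‖v j - e j‖ ^ 2 / 2) • e j -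
      ∑' k : {k // k ≠ j}, (S k j / (lam j - lam k)) • e k‖)
    (hF : F = ∑' k : {k // k ≠ j}, (S k j / (lam j - lam k)) ^ 2)
    (he3 : e3 = |‖v j - e j‖ ^ 2 - F|) :
    (Summable fun k : {k // k ≠ j} => (S k j / (lam j - lam k)) ^ 2) ∧ F ≤ 2 * B + 2 * A ∧
    (N ≤ 1 / 64 → e1 ≤ 2 * (γ j * N) + |R j j| ∧ e2 ^ 2 ≤ 20 * (N * B) + 12 * B ^ 2 + 2 * A ∧
      e3 ≤ 4 * B ^ 2 + e2 * (√(2 * B) + √(2 * B + 2 * A))) ∧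
    e1 ≤ √Q + |S j j| ∧ e2 ≤ 1 + √(2 * B + 2 * A) ∧ e3 ≤ 2 + (2 * B + 2 * A) := by
  obtain ⟨hδs, hδB⟩ := hγ.summable_first_order (Δ := fun i k => S i k - R i k) hB
  have hSle : ∀ k : {k // k ≠ j}, (S k j / (lam j - lam k)) ^ 2 ≤
      2 * ((S k j - R k j) / (lam j - lam k)) ^ 2 + 2 * (R k j / (lam j - lam k)) ^ 2 := by
    intro k
    have : S k j / (lam j - lam k) =
        (S k j - R k j) / (lam j - lam k) + R k j / (lam j - lam k) := by ring
    rw [this]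
    nlinarith [sq_nonneg ((S k j - R k j) / (lam j - lam k) - R k j / (lam j - lam k))]
  have hsum := (hδs.mul_left 2).add (hA.summable.mul_left 2)
  have hSs : Summable fun k : {k // k ≠ j} => (S k j / (lam j - lam k)) ^ 2 :=
    Summable.of_nonneg_of_le (fun _ => sq_nonneg _) hSle hsum
  have hFB : F ≤ 2 * B + 2 * A := by
    rw [hF]
    refine (hSs.tsum_le_tsum hSle hsum).trans ?_
    rw [(hδs.mul_left 2).tsum_add (hA.summable.mul_left 2), tsum_mul_left, tsum_mul_left,
      hA.tsum_eq]
    linarith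
  obtain ⟨hv1, hv2, hv3⟩ := h.orthonormal.eigenvector_error (hs.orthonormal.1 j) hsign hSs
  rw [← he2, ← hF] at hv1 hv3
  rw [← hF, ← he3] at hv2
  rw [← he3] at hv3
  have he20 : 0 ≤ e2 := he2 ▸ norm_nonneg _
  refine ⟨hSs, hFB, fun hN1 => ?_, ?_, hv1.trans ?_, hv2.trans (by linarith)⟩
  · obtain ⟨h1, h2, h3, h4⟩ := h.expansion hs hγ hN hB hN1 hsign
    obtain ⟨hw, hw3⟩ := hv3 h2
    refine ⟨?_, ?_, ?_⟩
    · rw [he1]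
      have : μ j - lam j - S j j = (μ j - lam j - (S j j - R j j)) - R j j := by ring
      rw [this]
      exact (abs_sub _ _).trans (by linarith)
    · rw [hw]
      have hle : ∀ k : {k // k ≠ j}, (inner ℝ (e k) (v j) - S k j / (lam j - lam k)) ^ 2 ≤
          2 * (inner ℝ (e k) (v j) - (S k j - R k j) / (lam j - lam k)) ^ 2 +
            2 * (R k j / (lam j - lam k)) ^ 2 := by
        intro k
        have : inner ℝ (e k) (v j) - S k j / (lam j - lam k) =
          (inner ℝ (e k) (v j) - (S k j - R k j) / (lam j - lam k)) -
            R k j / (lam j - lam k) := by ring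
        rw [this]
        nlinarith [sq_nonneg ((inner ℝ (e k) (v j) - (S k j - R k j) / (lam j - lam k)) +
          R k j / (lam j - lam k))]
      have hxs : Summable fun k : {k // k ≠ j} => inner ℝ (e k) (v j) ^ 2 :=
        (h.orthonormal.summable_inner_sq (v j)).comp_injective Subtype.val_injective
      have hus : Summable fun k : {k // k ≠ j} =>
          (inner ℝ (e k) (v j) - (S k j - R k j) / (lam j - lam k)) ^ 2 := by
        refine Summable.of_nonneg_of_le (fun _ => sq_nonneg _) (fun k => ?_)
          ((hxs.mul_left 2).add (hδs.mul_left 2))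
        nlinarith [sq_nonneg (inner ℝ (e k) (v j) + (S k j - R k j) / (lam j - lam k))]
      have hsum2 := (hus.mul_left 2).add (hA.summable.mul_left 2)
      refine ((Summable.of_nonneg_of_le (fun _ => sq_nonneg _) hle hsum2).tsum_le_tsum hle
        hsum2).trans ?_
      rw [(hus.mul_left 2).tsum_add (hA.summable.mul_left 2), tsum_mul_left, tsum_mul_left,
        hA.tsum_eq]
      linarith
    · refine hw3.trans (add_le_add ?_ (mul_le_mul_of_nonneg_left (add_le_add
        (Real.sqrt_le_sqrt h3) (Real.sqrt_le_sqrt hFB)) he20))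
      have h0 : inner ℝ (e j) (v j) ^ 2 ≤ 1 := by
        have := abs_real_inner_le_norm (e j) (v j)
        rw [h.orthonormal.1, hs.orthonormal.1, mul_one] at this
        rw [← sq_abs]
        exact pow_le_one₀ (abs_nonneg _) this
      nlinarith
  · rw [he1]
    -- Unit weights give the ordinary Weyl inequality with the Hilbert-Schmidt norm, which needs no
    -- smallness of `N`.
    have h1 := h.abs_eigenvalue_sub_le hs (γ := fun _ => 1) (fun _ => one_pos) (Γ := 1)
      (fun _ => le_rfl) (N := Q) (by simpa using hQ) j (t := √Q)
      (fun i hi => by linarith [h.antitone hi]) (fun i hi => by linarith [h.antitone hi])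
    exact (abs_sub _ _).trans (by linarith)
  · linarith [Real.sqrt_le_sqrt hFB]

set_option maxHeartbeats 4000000 in
/-- Bounds of the errors in terms of one scalar `X`, uniformly over the two cases of a small and a
large relative perturbation. -/
lemma exists_error_constant (c : ℝ) (hc : 1 ≤ c) (r : ℕ) : ∃ K : ℝ, 1 ≤ K ∧
    ∀ lam P u t σ X N B A Q gN sj rj e1 e2 e3 : ℝ, 0 ≤ lam → 0 ≤ P → 0 ≤ u → 0 < t → t ≤ 1 →
      t ≤ σ → σ ≤ c → 1 ≤ X → P ≤ c * t → 0 ≤ N → 0 ≤ B → 0 ≤ A → 0 ≤ e2 →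
      N ≤ c * (t * X) ^ 2 → gN ≤ c * (lam * u * t) * X ^ 2 → B ≤ c * (P * X) ^ 2 →
      A ≤ c * (P * σ * X) ^ 2 → Q ≤ c * (u * X) ^ 2 → sj ≤ c * (lam * u) * X →
      rj ≤ c * (lam * u * σ) * X →
      t ^ r ≤ c * (t * lam) → t ^ r ≤ c * (t * P) → t ^ r ≤ c * (t * P ^ 2) →
      (N ≤ 1 / 64 → e1 ≤ 2 * gN + rj ∧ e2 ^ 2 ≤ 20 * (N * B) + 12 * B ^ 2 + 2 * A ∧
        e3 ≤ 4 * B ^ 2 + e2 * (√(2 * B) + √(2 * B + 2 * A))) →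
      e1 ≤ √Q + sj → e2 ≤ 1 + √(2 * B + 2 * A) → e3 ≤ 2 + (2 * B + 2 * A) →
      e1 ≤ K * (lam * u * σ) * X ^ (r + 4) ∧ e2 ≤ K * (P * σ) * X ^ (r + 4) ∧
        e3 ≤ K * (P ^ 2 * σ) * X ^ (r + 4) := by
  have hc0 : 0 ≤ c := zero_le_one.trans hc
  have hp : 1 ≤ (8 * c) ^ r := one_le_pow₀ (by linarith)
  have hc2 : c ≤ c ^ 2 := by nlinarith
  have hc3 : c ^ 2 ≤ c ^ 3 := by nlinarith [sq_nonneg c]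
  have hc4 : c ^ 3 ≤ c ^ 4 := by nlinarith [pow_nonneg hc0 3]
  refine ⟨100 * c ^ 4 * (8 * c) ^ r, by nlinarith [one_le_pow₀ hc (n := 4)], ?_⟩
  intro lam P u t σ X N B A Q gN sj rj e1 e2 e3 hlam hP hu ht ht1 htσ hσ hX hPt hN0 hB0 hA0 he20
    hN hgN hB hA hQ hsj hrj hr1 hr2 hr3 hgood hb1 hb2 hb3
  have hX0 : 0 ≤ X := zero_le_one.trans hX
  have hσ0 : 0 ≤ σ := ht.le.trans htσ
  have hK : 100 * c ^ 4 ≤ 100 * c ^ 4 * (8 * c) ^ r :=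
    le_mul_of_one_le_right (by positivity) hp
  -- Since `X ≥ 1`, bounds with different constants and powers of `X` can all be raised to the
  -- common one.
  have hfin : ∀ (a k Z : ℝ) (n : ℕ), 0 ≤ Z → a ≤ k * Z * X ^ n → n ≤ r + 4 →
      k ≤ 100 * c ^ 4 * (8 * c) ^ r → a ≤ 100 * c ^ 4 * (8 * c) ^ r * Z * X ^ (r + 4) := by
    intro a k Z n hZ ha hn hk
    have h1 : X ^ n ≤ X ^ (r + 4) := pow_le_pow_right₀ hX hn
    refine ha.trans (mul_le_mul (mul_le_mul_of_nonneg_right hk hZ) h1 (by positivity)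
      (by positivity))
  have hAB : √(2 * B + 2 * A) ≤ 2 * c ^ 2 * (P * X) := by
    refine Real.sqrt_le_iff.2 ⟨by positivity, ?_⟩
    have h1 : (P * σ * X) ^ 2 ≤ c ^ 2 * (P * X) ^ 2 := by
      have : (P * σ * X) ^ 2 = σ ^ 2 * (P * X) ^ 2 := by ring
      rw [this]
      exact mul_le_mul_of_nonneg_right (pow_le_pow_left₀ hσ0 hσ 2) (sq_nonneg _)
    have h2 := mul_le_mul_of_nonneg_left h1 hc0
    have h3 : c + c * c ^ 2 ≤ 2 * c ^ 4 := by nlinarith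
    nlinarith [mul_le_mul_of_nonneg_right h3 (sq_nonneg (P * X))]
  have hBs : √(2 * B) ≤ 2 * c ^ 2 * (P * X) :=
    (Real.sqrt_le_sqrt (by linarith)).trans hAB
  rcases le_or_gt N (1 / 64) with hcase | hcase
  · obtain ⟨h1, h2, h3⟩ := hgood hcase
    have hw : e2 ≤ 6 * c ^ 2 * (P * σ) * X ^ 2 := by
      refine abs_le_of_sq_le_sq' (h2.trans ?_) (by positivity) |>.2
      have hNB : N * B ≤ c ^ 2 * (P * σ * X ^ 2) ^ 2 := by
        refine (mul_le_mul hN hB hB0 (by positivity)).trans ?_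
        have : c * (t * X) ^ 2 * (c * (P * X) ^ 2) = c ^ 2 * ((P * X ^ 2) ^ 2 * t ^ 2) := by ring
        rw [this]
        have : c ^ 2 * (P * σ * X ^ 2) ^ 2 = c ^ 2 * ((P * X ^ 2) ^ 2 * σ ^ 2) := by ring
        rw [this]
        gcongr
      -- One of the two factors `P` is traded for the rate through `P ≤ c * t ≤ c * σ`.
      have hBB : B ^ 2 ≤ c ^ 4 * (P * σ * X ^ 2) ^ 2 := by
        refine (pow_le_pow_left₀ hB0 hB 2).trans ?_
        have : (c * (P * X) ^ 2) ^ 2 = c ^ 2 * (P * X ^ 2) ^ 2 * P ^ 2 := by ring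
        rw [this]
        have : c ^ 4 * (P * σ * X ^ 2) ^ 2 = c ^ 2 * (P * X ^ 2) ^ 2 * (c * σ) ^ 2 := by ring
        rw [this]
        have : P ≤ c * σ := hPt.trans (by gcongr)
        gcongr
      have hAA : A ≤ c * (P * σ * X ^ 2) ^ 2 := by
        refine hA.trans ?_
        have : X ≤ X ^ 2 := by nlinarith
        gcongr
      have h4 : 20 * c ^ 2 + 12 * c ^ 4 + 2 * c ≤ 36 * c ^ 4 := by linarith
      have h5 := mul_le_mul_of_nonneg_right h4 (sq_nonneg (P * σ * X ^ 2))
      nlinarith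
    refine ⟨hfin _ (3 * c) _ 2 (by positivity) ?_ (by omega) (by linarith),
      hfin _ (6 * c ^ 2) _ 2 (by positivity) hw (by omega) (by linarith),
      hfin _ (28 * c ^ 4) _ 4 (by positivity) ?_ (by omega)
        (by linarith [pow_nonneg hc0 4])⟩
    · have h4 : c * (lam * u * t) * X ^ 2 ≤ c * (lam * u * σ) * X ^ 2 := by gcongr
      have h5 : c * (lam * u * σ) * X ≤ c * (lam * u * σ) * X ^ 2 := by
        have : X ≤ X ^ 2 := by nlinarith
        gcongr
      linarith
    · have h4 : B ^ 2 ≤ c ^ 4 * (P ^ 2 * σ) * X ^ 4 := by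
        refine (pow_le_pow_left₀ hB0 hB 2).trans ?_
        have : (c * (P * X) ^ 2) ^ 2 = c ^ 2 * P ^ 2 * (P * P) * X ^ 4 := by ring
        rw [this]
        have : c ^ 4 * (P ^ 2 * σ) * X ^ 4 = c ^ 2 * P ^ 2 * ((c * σ) * (c * 1)) * X ^ 4 := by ring
        rw [this]
        have h6 : P ≤ c * σ := hPt.trans (by gcongr)
        have h7 : P ≤ c * 1 := hPt.trans (by gcongr)
        gcongr
      have h5 : e2 * (√(2 * B) + √(2 * B + 2 * A)) ≤
          (6 * c ^ 2 * (P * σ) * X ^ 2) * (4 * c ^ 2 * (P * X)) :=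
        mul_le_mul hw (by linarith) (by positivity) (by positivity)
      have h6 : (6 * c ^ 2 * (P * σ) * X ^ 2) * (4 * c ^ 2 * (P * X)) =
        24 * c ^ 4 * (P ^ 2 * σ) * X ^ 3 := by ring
      have h7 : 24 * c ^ 4 * (P ^ 2 * σ) * X ^ 3 ≤ 24 * c ^ 4 * (P ^ 2 * σ) * X ^ 4 := by
        have : X ^ 3 ≤ X ^ 4 := pow_le_pow_right₀ hX (by norm_num)
        gcongr
      linarith
  -- Large `N` means that `t * X` is bounded below. Its `r`-th power supplies the missing factors
  -- `lam`, `P`, `P ^ 2` and `t` in the crude bounds, at the price of `X ^ r`.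
  · have h1 : 1 ≤ 8 * c * (t * X) := by
      have h2 : (1 : ℝ) ^ 2 ≤ (8 * c * (t * X)) ^ 2 := by
        have h3 := mul_le_mul_of_nonneg_right hc2 (sq_nonneg (t * X))
        nlinarith
      exact abs_le_of_sq_le_sq' h2 (by positivity) |>.2
    have h2 : 1 ≤ (8 * c) ^ r * X ^ r * t ^ r := by
      have := one_le_pow₀ h1 (n := r)
      calc (1 : ℝ) ≤ _ := this
        _ = _ := by rw [mul_pow, mul_pow t]; ring
    have hpX : 0 ≤ (8 * c) ^ r * X ^ r := by positivity
    have hXr : X ^ r ≤ X ^ (r + 2) := pow_le_pow_right₀ hX (by omega)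
    have hX2 : X ^ 2 ≤ X ^ (r + 2) := pow_le_pow_right₀ hX (by omega)
    have hXr3 : X ^ (r + 2) ≤ X ^ (r + 3) := pow_le_pow_right₀ hX (by omega)
    have hX3 : X ^ 3 ≤ X ^ (r + 3) := pow_le_pow_right₀ hX (by omega)
    have hXr1 : X ^ (r + 1) ≤ X ^ (r + 2) := pow_le_pow_right₀ hX (by omega)
    refine ⟨hfin _ (c ^ 2 * (8 * c) ^ r + 8 * c ^ 2) _ (r + 2) (by positivity) ?_ (by omega) ?_,
      hfin _ (c * (8 * c) ^ r + 16 * c ^ 3) _ (r + 2) (by positivity) ?_ (by omega) ?_,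
      hfin _ (2 * c * (8 * c) ^ r + 8 * c * (2 * c + 2 * c ^ 3)) _ (r + 3) (by positivity) ?_
        (by omega) ?_⟩
    · have hQ' : √Q ≤ c * (u * X) := by
        refine Real.sqrt_le_iff.2 ⟨by positivity, hQ.trans ?_⟩
        nlinarith [mul_le_mul_of_nonneg_right hc2 (sq_nonneg (u * X))]
      have h3 : √Q ≤ c ^ 2 * (8 * c) ^ r * (lam * u * σ) * X ^ (r + 2) := by
        calc √Q ≤ c * (u * X) * 1 := by linarith
          _ ≤ c * (u * X) * ((8 * c) ^ r * X ^ r * (c * (t * lam))) := by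
              refine mul_le_mul_of_nonneg_left (h2.trans ?_) (by positivity)
              exact mul_le_mul_of_nonneg_left hr1 hpX
          _ = c ^ 2 * (8 * c) ^ r * (lam * u * t) * X ^ (r + 1) := by ring
          _ ≤ _ := by gcongr
      have h4 : sj ≤ 8 * c ^ 2 * (lam * u * σ) * X ^ (r + 2) := by
        calc sj ≤ c * (lam * u) * X * 1 := by linarith
          _ ≤ c * (lam * u) * X * (8 * c * (t * X)) :=
              mul_le_mul_of_nonneg_left h1 (by positivity)
          _ = 8 * c ^ 2 * (lam * u * t) * X ^ 2 := by ring
          _ ≤ _ := by gcongr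
      linarith
    · have : c ^ 2 * (8 * c) ^ r ≤ c ^ 4 * (8 * c) ^ r := by
        gcongr; linarith
      have : c ^ 2 * 1 ≤ c ^ 4 * (8 * c) ^ r := by
        gcongr; linarith
      linarith
    · have h3 : 1 ≤ c * (8 * c) ^ r * (P * σ) * X ^ (r + 2) := by
        calc (1 : ℝ) ≤ _ := h2
          _ ≤ (8 * c) ^ r * X ^ r * (c * (t * P)) := mul_le_mul_of_nonneg_left hr2 hpX
          _ = c * (8 * c) ^ r * (P * t) * X ^ r := by ring
          _ ≤ _ := by gcongr
      have h4 : √(2 * B + 2 * A) ≤ 16 * c ^ 3 * (P * σ) * X ^ (r + 2) := by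
        calc √(2 * B + 2 * A) ≤ 2 * c ^ 2 * (P * X) * 1 := by linarith
          _ ≤ 2 * c ^ 2 * (P * X) * (8 * c * (t * X)) :=
              mul_le_mul_of_nonneg_left h1 (by positivity)
          _ = 16 * c ^ 3 * (P * t) * X ^ 2 := by ring
          _ ≤ _ := by gcongr
      linarith
    · have : c * (8 * c) ^ r ≤ c ^ 4 * (8 * c) ^ r := by
        gcongr; linarith
      have : c ^ 3 * 1 ≤ c ^ 4 * (8 * c) ^ r := by gcongr
      linarith
    · have h3 : 1 ≤ c * (8 * c) ^ r * (P ^ 2 * σ) * X ^ (r + 3) := by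
        calc (1 : ℝ) ≤ _ := h2
          _ ≤ (8 * c) ^ r * X ^ r * (c * (t * P ^ 2)) := mul_le_mul_of_nonneg_left hr3 hpX
          _ = c * (8 * c) ^ r * (P ^ 2 * t) * X ^ r := by ring
          _ ≤ _ := by gcongr; omega
      have h4 : 2 * B + 2 * A ≤ 8 * c * (2 * c + 2 * c ^ 3) * (P ^ 2 * σ) * X ^ (r + 3) := by
        have h5 : (P * σ * X) ^ 2 ≤ c ^ 2 * (P * X) ^ 2 := by
          have : (P * σ * X) ^ 2 = σ ^ 2 * (P * X) ^ 2 := by ring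
          rw [this]
          exact mul_le_mul_of_nonneg_right (pow_le_pow_left₀ hσ0 hσ 2) (sq_nonneg _)
        have h6 := mul_le_mul_of_nonneg_left h5 hc0
        calc 2 * B + 2 * A ≤ (2 * c + 2 * c ^ 3) * (P * X) ^ 2 * 1 := by linarith
          _ ≤ (2 * c + 2 * c ^ 3) * (P * X) ^ 2 * (8 * c * (t * X)) :=
              mul_le_mul_of_nonneg_left h1 (by positivity)
          _ = 8 * c * (2 * c + 2 * c ^ 3) * (P ^ 2 * t) * X ^ 3 := by ring
          _ ≤ _ := by gcongr
      linarith
    · have : c * (8 * c) ^ r ≤ c ^ 4 * (8 * c) ^ r := by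
        gcongr; linarith
      have : c ^ 4 * 1 ≤ c ^ 4 * (8 * c) ^ r := by gcongr
      nlinarith

end Vectors

/-! ### Moments of weighted norms and of maxima. -/

section Moments

/-- Jensen's inequality for weighted series. -/
lemma ENNReal.tsum_mul_rpow_le {ι : Type*} (c f : ι → ℝ≥0∞) {s : ℝ} (hs : 1 ≤ s) {b : ℝ≥0∞}
    (hb : ∑' i, c i ≤ b) : (∑' i, c i * f i) ^ s ≤ b ^ (s - 1) * ∑' i, c i * f i ^ s := by
  have hs0 : 0 < s := by linarith
  have h1 : ∑' i, c i * f i ≤ b ^ (1 - s⁻¹) * (∑' i, c i * f i ^ s) ^ s⁻¹ := by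
    rw [ENNReal.tsum_eq_iSup_sum]
    refine iSup_le fun t => ?_
    refine (ENNReal.inner_le_weight_mul_Lp_of_nonneg t hs c f).trans ?_
    gcongr
    · exact sub_nonneg.2 (inv_le_one_of_one_le₀ hs)
    · exact (ENNReal.sum_le_tsum t).trans hb
    · exact ENNReal.sum_le_tsum t
  calc (∑' i, c i * f i) ^ s ≤ (b ^ (1 - s⁻¹) * (∑' i, c i * f i ^ s) ^ s⁻¹) ^ s := by gcongr
    _ = _ := by
      rw [ENNReal.mul_rpow_of_nonneg _ _ hs0.le, ← ENNReal.rpow_mul, ← ENNReal.rpow_mul,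
        inv_mul_cancel₀ hs0.ne', ENNReal.rpow_one, sub_mul, inv_mul_cancel₀ hs0.ne', one_mul]

variable {Ω : Type*} [MeasurableSpace Ω] {P : Measure Ω}

/-- A weighted `ℓ²` norm of variables with bounded moments of order `q ≥ 2` has a bounded moment of
order `q`. -/
lemma exists_weighted_l2_norm {ι : Type*} [Countable ι] {c : ι → ℝ} (hc : ∀ i, 0 ≤ c i)
    (hcs : Summable c) {b : ℝ} (hb : ∑' i, c i ≤ b) {τ : ι → Ω → ℝ}
    (hτ : ∀ i, AEStronglyMeasurable (τ i) P) {q t : ℝ} (hq : 2 ≤ q)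
    (hτt : ∀ i, eLpNorm (τ i) (ENNReal.ofReal q) P ≤ ENNReal.ofReal t) :
    ∃ G : Ω → ℝ, AEStronglyMeasurable G P ∧ (∀ ω, 0 ≤ G ω) ∧
      eLpNorm G (ENNReal.ofReal q) P ≤ ENNReal.ofReal (√b * t) ∧
      ∀ᵐ ω ∂P, HasSum (fun i => c i * τ i ω ^ 2) (G ω ^ 2) := by
  have hq0 : 0 < q := by linarith
  have hb0 : 0 ≤ b := (tsum_nonneg hc).trans hb
  let Z : Ω → ℝ≥0∞ := fun ω => ∑' i, ENNReal.ofReal (c i) * ‖τ i ω‖ₑ ^ (2 : ℝ)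
  have hterm : ∀ i, AEMeasurable (fun ω => ENNReal.ofReal (c i) * ‖τ i ω‖ₑ ^ (2 : ℝ)) P :=
    fun i => ((hτ i).enorm.pow_const _).const_mul _
  have hZm : AEMeasurable Z P := AEMeasurable.tsum hterm
  have hmom : ∀ i, ∫⁻ ω, ‖τ i ω‖ₑ ^ q ∂P ≤ ENNReal.ofReal t ^ q := by
    intro i
    have h1 := hτt i
    rw [eLpNorm_eq_lintegral_rpow_enorm_toReal (by simpa using hq0) ENNReal.ofReal_ne_top,
      ENNReal.toReal_ofReal hq0.le, one_div] at h1
    exact (ENNReal.rpow_inv_le_iff hq0).1 h1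
  have hcb : ∑' i, ENNReal.ofReal (c i) ≤ ENNReal.ofReal b := by
    rw [← ENNReal.ofReal_tsum_of_nonneg hc hcs]
    exact ENNReal.ofReal_le_ofReal hb
  have hint : ∫⁻ ω, Z ω ^ (q / 2) ∂P ≤ ENNReal.ofReal b ^ (q / 2) * ENNReal.ofReal t ^ q := by
    calc ∫⁻ ω, Z ω ^ (q / 2) ∂P
        ≤ ∫⁻ ω, ENNReal.ofReal b ^ (q / 2 - 1) *
            ∑' i, ENNReal.ofReal (c i) * ‖τ i ω‖ₑ ^ q ∂P := by
          refine lintegral_mono fun ω => ?_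
          refine (ENNReal.tsum_mul_rpow_le _ _ (by linarith) hcb).trans_eq ?_
          congr 2
          ext i
          rw [← ENNReal.rpow_mul]
          congr 2
          ring
      _ = ENNReal.ofReal b ^ (q / 2 - 1) *
            ∑' i, ENNReal.ofReal (c i) * ∫⁻ ω, ‖τ i ω‖ₑ ^ q ∂P := by
          rw [lintegral_const_mul'' _ (AEMeasurable.tsum fun i =>
            ((hτ i).enorm.pow_const _).const_mul _),
            lintegral_tsum fun i => ((hτ i).enorm.pow_const _).const_mul _]
          congr 2
          ext i
          rw [lintegral_const_mul'' _ ((hτ i).enorm.pow_const _)]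
      _ ≤ ENNReal.ofReal b ^ (q / 2 - 1) *
            ∑' i, ENNReal.ofReal (c i) * ENNReal.ofReal t ^ q := by
          gcongr with i
          exact hmom i
      _ ≤ ENNReal.ofReal b ^ (q / 2 - 1) * (ENNReal.ofReal b * ENNReal.ofReal t ^ q) := by
          rw [ENNReal.tsum_mul_right]
          gcongr
      _ = ENNReal.ofReal b ^ (q / 2) * ENNReal.ofReal t ^ q := by
          rw [← mul_assoc]
          congr 1
          nth_rewrite 2 [← ENNReal.rpow_one (ENNReal.ofReal b)]
          rw [← ENNReal.rpow_add_of_nonneg _ _ (by linarith) zero_le_one, sub_add_cancel]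
  -- The moment bound also provides the almost sure convergence of the series.
  have hfin : ∀ᵐ ω ∂P, Z ω < ⊤ := by
    have h1 : ∀ᵐ ω ∂P, Z ω ^ (q / 2) < ⊤ := by
      refine ae_lt_top' (hZm.pow_const _) (hint.trans_lt ?_).ne
      exact ENNReal.mul_lt_top (ENNReal.rpow_lt_top_of_nonneg (by linarith) ENNReal.ofReal_ne_top)
        (ENNReal.rpow_lt_top_of_nonneg hq0.le ENNReal.ofReal_ne_top)
    filter_upwards [h1] with ω hω
    exact (ENNReal.rpow_lt_top_iff_of_pos (by linarith)).1 hω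
  refine ⟨fun ω => √(Z ω).toReal, ?_, fun ω => Real.sqrt_nonneg _, ?_, ?_⟩
  · exact hZm.ennreal_toReal.sqrt.aestronglyMeasurable
  · rw [eLpNorm_eq_lintegral_rpow_enorm_toReal (by simpa using hq0) ENNReal.ofReal_ne_top,
      ENNReal.toReal_ofReal hq0.le, one_div, ENNReal.rpow_inv_le_iff hq0]
    have h2 : ∀ᵐ ω ∂P, ‖√(Z ω).toReal‖ₑ ^ q = Z ω ^ (q / 2) := by
      filter_upwards [hfin] with ω hω
      rw [Real.enorm_eq_ofReal (Real.sqrt_nonneg _), Real.sqrt_eq_rpow,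
        ← ENNReal.ofReal_rpow_of_nonneg ENNReal.toReal_nonneg (by norm_num),
        ENNReal.ofReal_toReal hω.ne, ← ENNReal.rpow_mul]
      congr 1; ring
    rw [lintegral_congr_ae h2]
    refine hint.trans_eq ?_
    rw [ENNReal.ofReal_mul (Real.sqrt_nonneg _), ENNReal.mul_rpow_of_nonneg _ _ hq0.le,
      Real.sqrt_eq_rpow, ← ENNReal.ofReal_rpow_of_nonneg hb0 (by norm_num), ← ENNReal.rpow_mul]
    congr 2; ring
  · filter_upwards [hfin] with ω hω
    have hne : ∀ i, ENNReal.ofReal (c i) * ‖τ i ω‖ₑ ^ (2 : ℝ) ≠ ⊤ :=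
      ENNReal.ne_top_of_tsum_ne_top hω.ne
    have h1 := (ENNReal.summable_toReal hω.ne).hasSum
    rw [← ENNReal.tsum_toReal_eq hne] at h1
    simp only [Real.sq_sqrt ENNReal.toReal_nonneg]
    refine HasSum.of_forall_eq h1 fun i => ?_
    rw [ENNReal.toReal_mul, ENNReal.toReal_ofReal (hc i), ← ENNReal.toReal_rpow, toReal_enorm]
    norm_num

/-- The `L^p` norm of a `k`-th power is the `k`-th power of the `L^(pk)` norm. On a probability
space the latter is controlled by the `L^q` norm, and the triangle inequality accounts for the
summand `1`. -/
lemma eLpNorm_const_mul_one_add_pow_le [IsProbabilityMeasure P] {G : Ω → ℝ}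
    (hG : AEStronglyMeasurable G P) (hG0 : ∀ ω, 0 ≤ G ω) {p q b δ : ℝ} {k : ℕ} (hp : 1 ≤ p)
    (hk : 1 ≤ k) (hkq : p * k ≤ q) (hb : 0 ≤ b) (hδ : 0 ≤ δ)
    (hGb : eLpNorm G (ENNReal.ofReal q) P ≤ ENNReal.ofReal b) :
    eLpNorm (fun ω => δ * (1 + G ω) ^ k) (ENNReal.ofReal p) P ≤
      ENNReal.ofReal (δ * (1 + b) ^ k) := by
  have hk0 : (0 : ℝ) < k := by exact_mod_cast hk
  have hk1 : (1 : ℝ) ≤ k := by exact_mod_cast hk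
  have hpk : 1 ≤ p * k := by nlinarith
  have hm : AEStronglyMeasurable (fun ω => 1 + G ω) P := aestronglyMeasurable_const.add hG
  have h1 : eLpNorm (fun ω => 1 + G ω) (ENNReal.ofReal (p * k)) P ≤ ENNReal.ofReal (1 + b) := by
    refine (eLpNorm_le_eLpNorm_of_exponent_le (ENNReal.ofReal_le_ofReal hkq) hm).trans ?_
    refine (eLpNorm_add_le aestronglyMeasurable_const hG
      (ENNReal.one_le_ofReal.2 (hpk.trans hkq))).trans ?_
    rw [ENNReal.ofReal_add zero_le_one hb]
    refine add_le_add ?_ hGb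
    rw [eLpNorm_const _ (by simp; linarith) (IsProbabilityMeasure.ne_zero P)]
    simp
  have h2 : (fun ω => δ * (1 + G ω) ^ k) = δ • fun ω => ‖1 + G ω‖ ^ (k : ℝ) := by
    ext ω
    have : 0 ≤ 1 + G ω := by linarith [hG0 ω]
    simp [abs_of_nonneg this]
  rw [h2, eLpNorm_const_smul, eLpNorm_norm_rpow _ hk0, ENNReal.ofReal_mul hδ,
    Real.enorm_eq_ofReal hδ, ← ENNReal.ofReal_mul (by linarith), ENNReal.rpow_natCast,
    ENNReal.ofReal_pow (by linarith)]
  gcongr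

/-- The maximal inequality for `J` variables with a common bound in `L^p`. -/
lemma eLpNorm_maxUpTo_le {J : ℕ+} {f g : ℕ+ → Ω → ℝ} (hf : ∀ j ω, 0 ≤ f j ω)
    (hg : ∀ j, j ≤ J → AEStronglyMeasurable (g j) P)
    (hfg : ∀ j, j ≤ J → ∀ᵐ ω ∂P, f j ω ≤ g j ω) {p b : ℝ} (hp : 1 ≤ p) (hb : 0 ≤ b)
    (hgb : ∀ j, j ≤ J → eLpNorm (g j) (ENNReal.ofReal p) P ≤ ENNReal.ofReal b) :
    eLpNorm (fun ω => maxUpTo J fun j => f j ω) (ENNReal.ofReal p) P ≤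
      ENNReal.ofReal (b * ((J : ℕ) : ℝ) ^ (1 / p)) := by
  have hp0 : 0 < p := by linarith
  have hmom : ∀ j ∈ Finset.Icc 1 J, ∫⁻ ω, ‖g j ω‖ₑ ^ p ∂P ≤ ENNReal.ofReal b ^ p := by
    intro j hj
    have h1 := hgb j (Finset.mem_Icc.1 hj).2
    rw [eLpNorm_eq_lintegral_rpow_enorm_toReal (by simpa using hp0) ENNReal.ofReal_ne_top,
      ENNReal.toReal_ofReal hp0.le, one_div] at h1
    exact (ENNReal.rpow_inv_le_iff hp0).1 h1
  rw [eLpNorm_eq_lintegral_rpow_enorm_toReal (by simpa using hp0) ENNReal.ofReal_ne_top,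
    ENNReal.toReal_ofReal hp0.le, one_div, ENNReal.rpow_inv_le_iff hp0]
  have hae : ∀ᵐ ω ∂P, ∀ j ∈ Finset.Icc 1 J, f j ω ≤ g j ω :=
    (Filter.eventually_all_finset _).2 fun j hj => hfg j (Finset.mem_Icc.1 hj).2
  calc ∫⁻ ω, ‖maxUpTo J fun j => f j ω‖ₑ ^ p ∂P
      ≤ ∫⁻ ω, ∑ j ∈ Finset.Icc 1 J, ‖g j ω‖ₑ ^ p ∂P := by
        -- The `p`-th power of a maximum is at most the sum of the `p`-th powers. Only the
        -- dominating `g j` enter the sum, so no measurability of `f j` is needed.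
        refine lintegral_mono_ae ?_
        filter_upwards [hae] with ω hω
        obtain ⟨j, hj, hmax⟩ := Finset.exists_mem_eq_sup' (Finset.nonempty_Icc.2 (one_le (a := J)))
          fun j => f j ω
        have h1 : (maxUpTo J fun j => f j ω) = f j ω := hmax
        rw [h1]
        refine le_trans ?_ (Finset.single_le_sum (f := fun j => ‖g j ω‖ₑ ^ p)
          (fun _ _ => zero_le) hj)
        have h2 : ‖f j ω‖ₑ ≤ ‖g j ω‖ₑ := by
          rw [Real.enorm_eq_ofReal (hf j ω), Real.enorm_eq_ofReal ((hf j ω).trans (hω j hj))]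
          exact ENNReal.ofReal_le_ofReal (hω j hj)
        gcongr
    _ = ∑ j ∈ Finset.Icc 1 J, ∫⁻ ω, ‖g j ω‖ₑ ^ p ∂P :=
        lintegral_finsetSum' _ fun j hj => ((hg j (Finset.mem_Icc.1 hj).2).enorm.pow_const _)
    _ ≤ ∑ j ∈ Finset.Icc 1 J, ENNReal.ofReal b ^ p := Finset.sum_le_sum hmom
    _ = ENNReal.ofReal (b * ((J : ℕ) : ℝ) ^ p⁻¹) ^ p := by
        rw [Finset.sum_const, PNat.card_Icc, ENNReal.ofReal_mul hb,
          ENNReal.mul_rpow_of_nonneg _ _ hp0.le,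
          ENNReal.ofReal_rpow_of_nonneg (x := ((J : ℕ) : ℝ) ^ p⁻¹) (by positivity) hp0.le,
          ← Real.rpow_mul (by positivity), inv_mul_cancel₀ hp0.ne', Real.rpow_one,
          ENNReal.ofReal_natCast, nsmul_eq_mul, mul_comm]
        simp

end Moments

/-! ### From extended real gap sums to real series. -/

section Gaps

lemma hasSum_toReal_tsum_div {ι : Type*} {a b : ι → ℝ} (ha : ∀ i, 0 ≤ a i) (hb : ∀ i, 0 ≤ b i)
    (h : ∑' i, ENNReal.ofReal (a i) / ENNReal.ofReal (b i) ≠ ⊤) :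
    HasSum (fun i => a i / b i) (∑' i, ENNReal.ofReal (a i) / ENNReal.ofReal (b i)).toReal := by
  have h1 := (ENNReal.summable_toReal h).hasSum
  rw [← ENNReal.tsum_toReal_eq (ENNReal.ne_top_of_tsum_ne_top h)] at h1
  refine HasSum.of_forall_eq h1 fun i => ?_
  rw [ENNReal.toReal_div, ENNReal.toReal_ofReal (ha i), ENNReal.toReal_ofReal (hb i)]

lemma ENNReal.ne_top_and_le_of_ofReal_mul_le {x c : ℝ} {T : ℝ≥0∞} (hx : 0 < x) (hc : 0 ≤ c)
    (h : ENNReal.ofReal x * T ≤ ENNReal.ofReal c) : T ≠ ⊤ ∧ x * T.toReal ≤ c := by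
  constructor
  · rintro rfl
    rw [ENNReal.mul_top (by simpa using hx)] at h
    exact ENNReal.ofReal_ne_top (top_le_iff.1 h)
  · have := ENNReal.toReal_mono ENNReal.ofReal_ne_top h
    rwa [ENNReal.toReal_mul, ENNReal.toReal_ofReal hx.le, ENNReal.toReal_ofReal hc] at this

end Gaps

/-! ### Entries of the operators and consequences of the gap assumptions. -/

namespace EigenModel

variable {Ω H : Type*} [NormedAddCommGroup H] [InnerProductSpace ℝ H] {M : EigenModel Ω H}

/-- Entries of an operator given by a double series. -/
lemma inner_eq_of_hasSum_entries {e : ℕ+ → H} (he : Orthonormal ℝ e) {c : ℕ+ → ℕ+ → ℝ} {x : H}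
    {i : ℕ+} (hx : HasSum (fun ij : ℕ+ × ℕ+ => (c ij.1 ij.2 * inner ℝ (e ij.1) (e i)) • e ij.2) x)
    (k : ℕ+) : inner ℝ (e k) x = c i k := by
  refine (hx.inner_right (e k)).unique ?_
  convert hasSum_single (i, k) ?_ using 1
  · simp [inner_smul_right, he.1]
  · rintro ⟨i', k'⟩ hne
    simp only [inner_smul_right]
    by_cases hi : i' = i
    · have hk : k ≠ k' := fun hk => hne (by rw [hi, hk])
      rw [he.2 hk, mul_zero]
    · rw [he.2 hi, mul_zero, zero_mul]

variable [MeasurableSpace Ω] {P : Measure Ω}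

lemma IsRepresented.inner_e_D (h : M.IsRepresented P) (i k : ℕ+) :
    inner ℝ (M.e k) (M.D (M.e i)) = M.lam k * inner ℝ (M.e k) (M.e i) :=
  h.e_orthonormal.inner_eq_of_hasSum (h.D_spectral (M.e i)) k

/-- Comparing the `(j, j)` entries of the two representations of `D` determines the weights. -/
lemma IsRepresented.lamT_mul_mean (h : M.IsRepresented P) (j : ℕ+) :
    M.lamT j * ∫ ω, M.etaD j j ω ∂P = M.lam j := by
  have h1 := inner_eq_of_hasSum_entries h.e_orthonormal
    (c := fun i k => √(M.lamT i * M.lamT k) * ∫ ω, M.etaD i k ω ∂P) (h.D_scores (M.e j)) j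
  rw [h.inner_e_D, real_inner_self_eq_norm_sq, h.e_orthonormal.1,
    Real.sqrt_mul_self (h.lamT_nonneg j)] at h1
  linarith

/-- The contribution of the negligible part of the scores. -/
noncomputable def negligibleTerm (M : EigenModel Ω H) (k j : ℕ+) (ω : Ω) : ℝ :=
  √(M.lamT k * M.lamT j) * M.etaR k j ω

/-- Subtracting the two double series gives the entries. Their symmetry is not assumed for the
scores; it is read off from the symmetry of `Dhat` and the diagonal form of `D`. -/
lemma IsRepresented.isEntryPerturbation (h : M.IsRepresented P) : ∀ᵐ ω ∂P,
    IsEntryPerturbation M.D (M.Dhat ω) M.lam M.e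
      fun i k => M.scoreTerm P i k ω - M.negligibleTerm i k ω := by
  filter_upwards [h.Dhat_scores, h.Dhat_symmetric] with ω h1 h2
  have hent : ∀ x, HasSum (fun ij : ℕ+ × ℕ+ =>
      ((M.scoreTerm P ij.1 ij.2 ω - M.negligibleTerm ij.1 ij.2 ω) *
        inner ℝ (M.e ij.1) x) • M.e ij.2) (M.Dhat ω x - M.D x) := by
    intro x
    convert (h1 x).sub (h.D_scores x) using 2 with ij
    rw [← sub_smul]
    simp only [scoreTerm, etaBar, negligibleTerm]
    congr 1
    ring
  refine ⟨h.lam_nonneg, h.lam_antitone, h.e_orthonormal, h.D_spectral, hent, fun i k => ?_⟩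
  have h3 := inner_eq_of_hasSum_entries h.e_orthonormal
    (c := fun i k => M.scoreTerm P i k ω - M.negligibleTerm i k ω) (hent (M.e i)) k
  have h4 := inner_eq_of_hasSum_entries h.e_orthonormal
    (c := fun i k => M.scoreTerm P i k ω - M.negligibleTerm i k ω) (hent (M.e k)) i
  rw [← h3, ← h4, inner_sub_right, inner_sub_right, h.inner_e_D, h.inner_e_D, ← h2, real_inner_comm]
  congr 1
  by_cases hik : i = k
  · rw [hik]
  · rw [h.e_orthonormal.2 hik, h.e_orthonormal.2 (Ne.symm hik), mul_zero, mul_zero]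

variable {a h p C m s : ℝ} {Jp j : ℕ+}

lemma SatisfiesAssumption.mean_pos (hM : M.SatisfiesAssumption P a h p C m s Jp) (hC : 0 < C)
    (j : ℕ+) : 0 < ∫ ω, M.etaD j j ω ∂P :=
  (one_div_pos.2 hC).trans_le (hM.mean_lower j)

lemma SatisfiesAssumption.lamT_eq (hM : M.SatisfiesAssumption P a h p C m s Jp) (hC : 0 < C)
    (j : ℕ+) : M.lamT j = M.lam j / ∫ ω, M.etaD j j ω ∂P := by
  rw [eq_div_iff (hM.mean_pos hC j).ne', hM.represented.lamT_mul_mean]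

lemma SatisfiesAssumption.lamT_le (hM : M.SatisfiesAssumption P a h p C m s Jp) (hC : 0 < C)
    (j : ℕ+) : M.lamT j ≤ C * M.lam j := by
  have h1 := hM.mean_lower j
  have h2 := hM.represented.lamT_mul_mean j
  have h3 := mul_le_mul_of_nonneg_left h1 (hM.represented.lamT_nonneg j)
  rw [h2, mul_one_div, div_le_iff₀ hC] at h3
  linarith

/-- Quantitative consequences of the assumptions for the eigenvalue gaps at an index below `Jp`. -/
structure GapFacts {Ω H : Type*} [NormedAddCommGroup H] [InnerProductSpace ℝ H]
    (M : EigenModel Ω H) (j : ℕ+) (C h m t W : ℝ) : Prop where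
  lam_lower : m ^ (-h) ≤ C * M.lam j
  lam_pos : 0 < M.lam j
  ne : ∀ k, k ≠ j → M.lam k ≠ M.lam j
  nonneg : 0 ≤ W
  hasSum_gap : HasSum (fun k : {k // k ≠ j} => M.lam k / |M.lam j - M.lam k|) W
  hasSum_gapSq : HasSum
    (fun k : {k // k ≠ j} => M.lam k * M.lam j / (M.lam j - M.lam k) ^ 2) (M.Lambda j)
  one_le : 1 ≤ C * (t * √m)
  le : W ≤ C * (t * √m)
  Lambda_le : M.Lambda j ≤ C * (t ^ 2 * m)
  Lambda_lower : m ^ (-h) ≤ C ^ 2 * M.Lambda j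
  Lambda_pos : 0 < M.Lambda j

lemma SatisfiesAssumption.gapFacts (hM : M.SatisfiesAssumption P a h p C m s Jp) (hC : 0 < C)
    (hm : 1 ≤ m) (hj : j < Jp) : M.GapFacts j C h m (m ^ (-a)) (M.gapSum j).toReal := by
  have hm0 : 0 < m := by linarith
  have hrep := hM.represented
  have hpow : 0 < m ^ (-h) := Real.rpow_pos_of_pos hm0 _
  have hJp : 0 < M.lam Jp := (div_pos hpow hC).trans_le hM.lam_lower
  have hjJp : M.lam Jp ≤ M.lam j := hrep.lam_antitone hj.le
  have hj0 : 0 < M.lam j := hJp.trans_le hjJp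
  have hjC : M.lam j ≤ C :=
    (hrep.lam_summable.le_tsum j fun k _ => hrep.lam_nonneg k).trans hM.trace_bound
  have hx1 : m ^ (-(1 / 2 : ℝ) + a) * (m ^ (-a) * √m) = 1 := by
    rw [Real.sqrt_eq_rpow, ← Real.rpow_add hm0, ← Real.rpow_add hm0]
    ring_nf
    simp
  have hx2 : m ^ (-1 + 2 * a) * ((m ^ (-a)) ^ 2 * m) = 1 := by
    rw [← Real.rpow_natCast (m ^ (-a)), ← Real.rpow_mul hm0.le]
    nth_rewrite 3 [← Real.rpow_one m]
    rw [← Real.rpow_add hm0, ← Real.rpow_add hm0]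
    push_cast
    ring_nf
    simp
  have hy1 : 0 < m ^ (-a) * √m := by positivity
  have hy2 : 0 < (m ^ (-a)) ^ 2 * m := by positivity
  have hconv1 : ∀ z, m ^ (-(1 / 2 : ℝ) + a) * z ≤ C → z ≤ C * (m ^ (-a) * √m) := by
    intro z hz
    have := mul_le_mul_of_nonneg_left hz hy1.le
    calc z = (m ^ (-(1 / 2 : ℝ) + a) * (m ^ (-a) * √m)) * z := by rw [hx1, one_mul]
      _ = (m ^ (-a) * √m) * (m ^ (-(1 / 2 : ℝ) + a) * z) := by ring
      _ ≤ _ := this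
      _ = _ := by ring
  have hconv2 : ∀ z, m ^ (-1 + 2 * a) * z ≤ C → z ≤ C * ((m ^ (-a)) ^ 2 * m) := by
    intro z hz
    have := mul_le_mul_of_nonneg_left hz hy2.le
    calc z = (m ^ (-1 + 2 * a) * ((m ^ (-a)) ^ 2 * m)) * z := by rw [hx2, one_mul]
      _ = ((m ^ (-a)) ^ 2 * m) * (m ^ (-1 + 2 * a) * z) := by ring
      _ ≤ _ := this
      _ = _ := by ring
  obtain ⟨hW1, hW2⟩ := ENNReal.ne_top_and_le_of_ofReal_mul_le
    (Real.rpow_pos_of_pos hm0 _) hC.le (hM.gapSum_bound j hj.le)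
  obtain ⟨hL1, hL2⟩ := ENNReal.ne_top_and_le_of_ofReal_mul_le
    (Real.rpow_pos_of_pos hm0 _) hC.le (hM.gapSumSq_bound j hj.le)
  -- A repeated eigenvalue would contribute a positive number divided by zero, making the gap sum
  -- infinite.
  have hne : ∀ k, k ≠ j → M.lam k ≠ M.lam j := by
    intro k hk hkj
    have h1 := ENNReal.ne_top_of_tsum_ne_top hW1 ⟨k, hk⟩
    simp only [hkj, sub_self, abs_zero, ENNReal.ofReal_zero] at h1
    exact h1 (ENNReal.div_zero (by simpa using hj0))
  have hsumSq : HasSum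
      (fun k : {k // k ≠ j} => M.lam k * M.lam j / (M.lam j - M.lam k) ^ 2) (M.Lambda j) :=
    hasSum_toReal_tsum_div
      (fun k : {k // k ≠ j} => mul_nonneg (hrep.lam_nonneg _) (hrep.lam_nonneg _))
      (fun k => sq_nonneg _) hL1
  -- In the gap sum at `Jp`, the term of index `j` is at least `1` because `lam j - lam Jp ≤ lam j`.
  -- This uses that `j` is strictly below `Jp`.
  have hone : m ^ (-(1 / 2 : ℝ) + a) * 1 ≤ C := by
    obtain ⟨hV1, hV2⟩ := ENNReal.ne_top_and_le_of_ofReal_mul_le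
      (Real.rpow_pos_of_pos hm0 _) hC.le (hM.gapSum_bound Jp le_rfl)
    refine le_trans (mul_le_mul_of_nonneg_left ?_ (Real.rpow_pos_of_pos hm0 _).le) hV2
    rw [← ENNReal.toReal_one]
    refine ENNReal.toReal_mono hV1 ?_
    refine le_trans ?_ (ENNReal.le_tsum (⟨j, hj.ne⟩ : {i // i ≠ Jp}))
    rw [ENNReal.le_div_iff_mul_le (Or.inr (by simpa using hj0)) (Or.inl ENNReal.ofReal_ne_top),
      one_mul]
    refine ENNReal.ofReal_le_ofReal ?_
    rw [abs_le]
    constructor <;> linarith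
  -- The single term of index `Jp` suffices: it is at least `lam Jp / lam j ≥ lam Jp / C`.
  have hLlow : m ^ (-h) ≤ C ^ 2 * M.Lambda j := by
    have h1 := le_hasSum hsumSq ⟨Jp, hj.ne'⟩ fun k _ =>
      div_nonneg (mul_nonneg (hrep.lam_nonneg _) (hrep.lam_nonneg _)) (sq_nonneg _)
    have h2 : M.lam Jp < M.lam j := lt_of_le_of_ne hjJp (hne Jp hj.ne')
    have h3 : 0 < (M.lam j - M.lam Jp) ^ 2 := pow_pos (by linarith) 2
    rw [div_le_iff₀ h3] at h1
    have h4 : (M.lam j - M.lam Jp) ^ 2 ≤ M.lam j * C := by nlinarith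
    have h5 : 0 ≤ M.Lambda j := ENNReal.toReal_nonneg
    have h6 : M.lam Jp * M.lam j ≤ (M.Lambda j * C) * M.lam j := by
      nlinarith [mul_le_mul_of_nonneg_left h4 h5]
    have h7 := le_of_mul_le_mul_right h6 hj0
    have h8 := hM.lam_lower
    rw [div_le_iff₀ hC] at h8
    nlinarith
  refine ⟨?_, hj0, hne, ENNReal.toReal_nonneg, ?_, hsumSq, ?_, ?_, ?_, hLlow, ?_⟩
  · have := hM.lam_lower
    rw [div_le_iff₀ hC] at this
    nlinarith
  · exact hasSum_toReal_tsum_div (fun k : {k // k ≠ j} => hrep.lam_nonneg _)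
      (fun k => abs_nonneg _) hW1
  · exact hconv1 1 hone
  · exact hconv1 _ hW2
  · exact hconv2 _ hL2
  · by_contra hcon
    nlinarith [sq_nonneg C]

end EigenModel

lemma hasSum_mul_of_nonneg {ι : Type*} {f g : ι → ℝ} {a b : ℝ} (hf0 : ∀ i, 0 ≤ f i)
    (hg0 : ∀ i, 0 ≤ g i) (hf : HasSum f a) (hg : HasSum g b) :
    HasSum (fun kl : ι × ι => f kl.1 * g kl.2) (a * b) :=
  hf.mul hg (hf.summable.mul_of_nonneg hg.summable hf0 hg0)

lemma hasSum_products {ι : Type*} {v b l : ι → ℝ} {x y V B L : ℝ} (hv0 : ∀ i, 0 ≤ v i)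
    (hb0 : ∀ i, 0 ≤ b i) (hl0 : ∀ i, 0 ≤ l i) (hv : HasSum v V) (hb : HasSum b B)
    (hl : HasSum l L) :
    HasSum (fun kl : ι × ι => v kl.1 * v kl.2 / x + b kl.1 * v kl.2 / y + l kl.1 * l kl.2)
      (V * V / x + B * V / y + L * L) :=
  (((hasSum_mul_of_nonneg hv0 hv0 hv hv).div_const x).add
    ((hasSum_mul_of_nonneg hb0 hv0 hb hv).div_const y)).add (hasSum_mul_of_nonneg hl0 hl0 hl hl)

/-! ### Gap weights, score weights and the size of the scores. -/

namespace EigenModel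

variable {Ω H : Type*} [NormedAddCommGroup H] [InnerProductSpace ℝ H] {M : EigenModel Ω H}

/-- The gaps of the eigenvalue `lam j`, with a value at `j` that is at most every gap. -/
noncomputable def gapWeight (M : EigenModel Ω H) (j : ℕ+) (W : ℝ) (k : ℕ+) : ℝ :=
  if k = j then M.lam j / (1 + W) else |M.lam j - M.lam k|

/-- Weights of the squared scores in the relative Hilbert-Schmidt norms of the perturbation. -/
noncomputable def scoreWeight (M : EigenModel Ω H) (j : ℕ+) (W : ℝ) (kl : ℕ+ × ℕ+) : ℝ :=
  (M.lam kl.1 / M.gapWeight j W kl.1) * (M.lam kl.2 / M.gapWeight j W kl.2) / (1 + 2 * W) ^ 2 +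
    (if kl.1 = j then 0 else M.gapWeight j W j / M.gapWeight j W kl.1 ^ 2) * M.lam kl.1 *
      (M.lam kl.2 / M.gapWeight j W kl.2) / M.Lambda j +
    M.lam kl.1 * M.lam kl.2

section Weights

variable {j : ℕ+} {C h m t W : ℝ}

lemma gapWeight_self : M.gapWeight j W j = M.lam j / (1 + W) := if_pos rfl

lemma gapWeight_of_ne {k : ℕ+} (hk : k ≠ j) : M.gapWeight j W k = |M.lam j - M.lam k| := if_neg hk

/-- Each term of the gap sum is at most `W`, so `lam k ≤ W |lam j - lam k|` and hence `lam j ≤ (1 +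
W) |lam j - lam k|`. This is the reason for the value `lam j / (1 + W)` at `j`. -/
lemma GapFacts.isGapWeight (hg : M.GapFacts j C h m t W) (h0 : ∀ k, 0 ≤ M.lam k) :
    IsGapWeight M.lam (M.gapWeight j W) j := by
  have hW := hg.nonneg
  have hW1 : 0 < 1 + W := by linarith
  have hle : M.lam j / (1 + W) ≤ M.lam j := div_le_self hg.lam_pos.le (by linarith)
  refine ⟨?_, fun k hk => gapWeight_of_ne hk, fun k => ?_, ?_⟩
  · rw [gapWeight_self]; exact div_pos hg.lam_pos hW1
  · by_cases hk : k = j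
    · rw [hk]
    · rw [gapWeight_of_ne hk, gapWeight_self, div_le_iff₀ hW1]
      have h1 := le_hasSum hg.hasSum_gap ⟨k, hk⟩ fun i _ => div_nonneg (h0 _) (abs_nonneg _)
      have h2 : 0 < |M.lam j - M.lam k| := abs_pos.2 (sub_ne_zero.2 (hg.ne k hk).symm)
      rw [div_le_iff₀ h2] at h1
      have h3 := le_abs_self (M.lam j - M.lam k)
      simp only at h1
      nlinarith
  · rw [gapWeight_self]; exact hle

lemma GapFacts.gapWeight_pos (hg : M.GapFacts j C h m t W) (h0 : ∀ k, 0 ≤ M.lam k) (k : ℕ+) :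
    0 < M.gapWeight j W k :=
  (hg.isGapWeight h0).pos.trans_le ((hg.isGapWeight h0).le_all k)

/-- The gaps contribute `W` and the diagonal value `1 + W`, so choosing `γ j` small only doubles the
order of the sum. -/
lemma GapFacts.hasSum_relative (hg : M.GapFacts j C h m t W) :
    HasSum (fun k => M.lam k / M.gapWeight j W k) (1 + 2 * W) := by
  have hW1 : 1 + W ≠ 0 := by have := hg.nonneg; positivity
  have h1 : HasSum (fun k : {k // k ≠ j} => M.lam k / M.gapWeight j W k) W :=
    hg.hasSum_gap.of_forall_eq fun k => by rw [gapWeight_of_ne k.2]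
  have h2 := (hasSum_ne_iff (f := fun k => M.lam k / M.gapWeight j W k)).1 h1
  have h3 : M.lam j / M.gapWeight j W j = 1 + W := by
    rw [gapWeight_self]
    have := hg.lam_pos.ne'
    field_simp
  rw [h3] at h2
  convert h2 using 1
  ring

lemma GapFacts.hasSum_relative_sq (hg : M.GapFacts j C h m t W) :
    HasSum (fun k => (if k = j then 0 else M.gapWeight j W j / M.gapWeight j W k ^ 2) * M.lam k)
      (M.Lambda j / (1 + W)) := by
  have h1 := (hg.hasSum_gapSq).mul_right (1 + W)⁻¹
  have h2 := (hasSum_ne_iff (j := j) (f := fun k =>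
    (if k = j then 0 else M.gapWeight j W j / M.gapWeight j W k ^ 2) * M.lam k)
    (s := M.Lambda j * (1 + W)⁻¹)).1 (h1.of_forall_eq fun k => by
      rw [if_neg k.2, gapWeight_of_ne k.2, gapWeight_self, sq_abs]
      ring)
  simpa [div_eq_mul_inv] using h2

lemma GapFacts.relativeSq_nonneg (hg : M.GapFacts j C h m t W) (h0 : ∀ k, 0 ≤ M.lam k) (k : ℕ+) :
    0 ≤ (if k = j then 0 else M.gapWeight j W j / M.gapWeight j W k ^ 2) := by
  split_ifs
  · exact le_rfl
  · exact div_nonneg (hg.gapWeight_pos h0 j).le (sq_nonneg _)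

lemma GapFacts.relative_nonneg (hg : M.GapFacts j C h m t W) (h0 : ∀ k, 0 ≤ M.lam k) (k : ℕ+) :
    0 ≤ M.lam k / M.gapWeight j W k :=
  div_nonneg (h0 k) (hg.gapWeight_pos h0 k).le

lemma GapFacts.weight_terms_nonneg (hg : M.GapFacts j C h m t W) (h0 : ∀ k, 0 ≤ M.lam k)
    (kl : ℕ+ × ℕ+) :
    0 ≤ (M.lam kl.1 / M.gapWeight j W kl.1) * (M.lam kl.2 / M.gapWeight j W kl.2) /
        (1 + 2 * W) ^ 2 ∧
    0 ≤ (if kl.1 = j then 0 else M.gapWeight j W j / M.gapWeight j W kl.1 ^ 2) * M.lam kl.1 *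
      (M.lam kl.2 / M.gapWeight j W kl.2) / M.Lambda j ∧
    0 ≤ M.lam kl.1 * M.lam kl.2 :=
  ⟨div_nonneg (mul_nonneg (hg.relative_nonneg h0 _) (hg.relative_nonneg h0 _)) (sq_nonneg _),
    div_nonneg (mul_nonneg (mul_nonneg (hg.relativeSq_nonneg h0 _) (h0 _))
      (hg.relative_nonneg h0 _)) hg.Lambda_pos.le, mul_nonneg (h0 _) (h0 _)⟩

lemma GapFacts.scoreWeight_nonneg (hg : M.GapFacts j C h m t W) (h0 : ∀ k, 0 ≤ M.lam k)
    (kl : ℕ+ × ℕ+) : 0 ≤ M.scoreWeight j W kl := by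
  obtain ⟨h1, h2, h3⟩ := hg.weight_terms_nonneg h0 kl
  exact add_nonneg (add_nonneg h1 h2) h3

/-- The divisors `(1 + 2 * W) ^ 2` and `Lambda j` normalize the first two product weights, so the
total mass stays bounded however small the gaps are. -/
lemma GapFacts.hasSum_scoreWeight (hg : M.GapFacts j C h m t W) (h0 : ∀ k, 0 ≤ M.lam k)
    (hs : Summable M.lam) :
    HasSum (M.scoreWeight j W)
      (1 + (1 + 2 * W) / (1 + W) + (∑' k, M.lam k) * ∑' k, M.lam k) := by
  have hW := hg.nonneg
  have hv := hg.hasSum_relative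
  have hb := hg.hasSum_relative_sq
  have hv0 := hg.relative_nonneg h0
  have e1 : (1 + 2 * W) * (1 + 2 * W) / (1 + 2 * W) ^ 2 = 1 := by
    have : 1 + 2 * W ≠ 0 := by positivity
    field_simp
  have e2 : M.Lambda j / (1 + W) * (1 + 2 * W) / M.Lambda j = (1 + 2 * W) / (1 + W) := by
    have := hg.Lambda_pos.ne'
    field_simp
  have key := hasSum_products (x := (1 + 2 * W) ^ 2) (y := M.Lambda j) hv0
    (fun k => mul_nonneg (hg.relativeSq_nonneg h0 k) (h0 k)) h0 hv hb hs.hasSum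
  rw [e1, e2] at key
  exact key

/-- This gives a pointwise bound for the `(j, j)` score in terms of the weighted norm. -/
lemma GapFacts.scoreWeight_diag (hg : M.GapFacts j C h m t W) (h0 : ∀ k, 0 ≤ M.lam k) :
    1 / 4 ≤ M.scoreWeight j W (j, j) := by
  obtain ⟨-, h2, h3⟩ := hg.weight_terms_nonneg h0 (j, j)
  have hW := hg.nonneg
  have hl := hg.lam_pos.ne'
  have h1 : (M.lam j / M.gapWeight j W j) * (M.lam j / M.gapWeight j W j) / (1 + 2 * W) ^ 2 =
      (1 + W) ^ 2 / (1 + 2 * W) ^ 2 := by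
    rw [gapWeight_self]
    field_simp
  have h4 : 1 / 4 ≤ (1 + W) ^ 2 / (1 + 2 * W) ^ 2 := by
    rw [le_div_iff₀ (by positivity)]
    nlinarith
  unfold scoreWeight
  rw [h1]
  linarith

end Weights

variable [MeasurableSpace Ω] {P : Measure Ω}

/-- The total normalized size of the scores. -/
noncomputable def scoreSize (M : EigenModel Ω H) (P : Measure Ω) (m σ : ℝ) (kl : ℕ+ × ℕ+) (ω : Ω) :
    ℝ :=
  √m * |M.etaBar P kl.1 kl.2 ω| + √m / σ * |M.etaR kl.1 kl.2 ω|

variable {a h p C m s σ : ℝ} {Jp : ℕ+}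

lemma scoreSize_nonneg (hσ : 0 ≤ σ) (kl : ℕ+ × ℕ+) (ω : Ω) : 0 ≤ M.scoreSize P m σ kl ω := by
  unfold scoreSize; positivity

lemma abs_etaBar_le (hσ : 0 ≤ σ) (k l : ℕ+) (ω : Ω) :
    √m * |M.etaBar P k l ω| ≤ M.scoreSize P m σ (k, l) ω := by
  have : 0 ≤ √m / σ * |M.etaR k l ω| := by positivity
  unfold scoreSize; linarith

lemma abs_etaR_le (hσ : 0 < σ) (k l : ℕ+) (ω : Ω) :
    √m * |M.etaR k l ω| ≤ σ * M.scoreSize P m σ (k, l) ω := by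
  have h1 : 0 ≤ σ * (√m * |M.etaBar P k l ω|) := by positivity
  have h2 : σ * (√m / σ * |M.etaR k l ω|) = √m * |M.etaR k l ω| := by field_simp
  unfold scoreSize
  rw [mul_add, h2]
  linarith

lemma SatisfiesAssumption.aestronglyMeasurable_etaBar
    (hM : M.SatisfiesAssumption P a h p C m s Jp) (k l : ℕ+) :
    AEStronglyMeasurable (M.etaBar P k l) P :=
  (hM.represented.etaD_integrable k l).aestronglyMeasurable.sub aestronglyMeasurable_const

lemma SatisfiesAssumption.aestronglyMeasurable_scoreSize
    (hM : M.SatisfiesAssumption P a h p C m s Jp) (kl : ℕ+ × ℕ+) :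
    AEStronglyMeasurable (M.scoreSize P m σ kl) P :=
  ((hM.aestronglyMeasurable_etaBar kl.1 kl.2).norm.const_mul _).add
    ((hM.represented.etaR_measurable kl.1 kl.2).norm.const_mul _)

/-- Dividing the negligible part by `σ ≥ s` leaves it with norm at most `1`, so both parts of the
score have size of order one. -/
lemma SatisfiesAssumption.eLpNorm_scoreSize_le (hM : M.SatisfiesAssumption P a h p C m s Jp)
    (hC : 0 < C) (hσ : 0 < σ) (hsσ : s ≤ σ) (hq : 1 ≤ momentOrder a h p)
    (kl : ℕ+ × ℕ+) :
    eLpNorm (M.scoreSize P m σ kl) (ENNReal.ofReal (momentOrder a h p)) P ≤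
      ENNReal.ofReal (C + 1) := by
  have h1 : AEStronglyMeasurable (fun ω => √m * ‖M.etaBar P kl.1 kl.2 ω‖) P :=
    (hM.aestronglyMeasurable_etaBar kl.1 kl.2).norm.const_mul _
  have h2 : AEStronglyMeasurable (fun ω => √m / σ * ‖M.etaR kl.1 kl.2 ω‖) P :=
    (hM.represented.etaR_measurable kl.1 kl.2).norm.const_mul _
  have e1 : eLpNorm (fun ω => √m * ‖M.etaBar P kl.1 kl.2 ω‖)
      (ENNReal.ofReal (momentOrder a h p)) P ≤ ENNReal.ofReal C := by
    have : (fun ω => √m * ‖M.etaBar P kl.1 kl.2 ω‖) =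
      √m • fun ω => ‖M.etaBar P kl.1 kl.2 ω‖ := rfl
    rw [this, eLpNorm_const_smul, eLpNorm_norm, Real.enorm_eq_ofReal (Real.sqrt_nonneg _)]
    exact hM.etaBar_bound _ _
  have e2 : eLpNorm (fun ω => √m / σ * ‖M.etaR kl.1 kl.2 ω‖)
      (ENNReal.ofReal (momentOrder a h p)) P ≤ ENNReal.ofReal 1 := by
    have : (fun ω => √m / σ * ‖M.etaR kl.1 kl.2 ω‖) =
      (σ⁻¹ * √m) • fun ω => ‖M.etaR kl.1 kl.2 ω‖ := by
      ext ω; simp only [Pi.smul_apply, smul_eq_mul]; ring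
    rw [this, eLpNorm_const_smul, eLpNorm_norm, Real.enorm_eq_ofReal (by positivity),
      ENNReal.ofReal_mul (by positivity), mul_assoc]
    refine (mul_le_mul_right (hM.etaR_bound _ _) _).trans ?_
    rw [← ENNReal.ofReal_mul (by positivity)]
    refine ENNReal.ofReal_le_ofReal ?_
    rw [inv_mul_le_iff₀ hσ]
    linarith
  refine (eLpNorm_add_le h1 h2 (ENNReal.one_le_ofReal.2 hq)).trans ?_
  rw [ENNReal.ofReal_add hC.le zero_le_one]
  exact add_le_add e1 e2

end EigenModel

lemma HasSum.exists_hasSum_le {ι : Type*} {f g : ι → ℝ} {b κ : ℝ} (hg : HasSum g b)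
    (hf : ∀ i, 0 ≤ f i) (hfg : ∀ i, f i ≤ κ * g i) : ∃ N, HasSum f N ∧ 0 ≤ N ∧ N ≤ κ * b := by
  have h1 := hg.mul_left κ
  have h2 := Summable.of_nonneg_of_le hf hfg h1.summable
  exact ⟨_, h2.hasSum, tsum_nonneg hf, hasSum_le hfg h2.hasSum h1⟩

/-! ### Weighted norms of the perturbation in terms of `G`. -/

namespace EigenModel

variable {Ω H : Type*} [NormedAddCommGroup H] [InnerProductSpace ℝ H] {M : EigenModel Ω H}

/-- The constant in the bounds of the weighted norms of the perturbation. -/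
noncomputable def sizeConstant (C c₀ : ℝ) : ℝ := 9 * (1 + C) ^ 4 * c₀ ^ 2

lemma sizeConstant_ge {C c₀ : ℝ} (hC : 0 < C) (hc₀ : 1 ≤ c₀) :
    1 ≤ sizeConstant C c₀ ∧ c₀ ≤ sizeConstant C c₀ ∧
    9 * (C ^ 2 * c₀ ^ 2) * C ^ 2 ≤ sizeConstant C c₀ ∧
    6 * (C ^ 2 * c₀ ^ 2) * C ≤ sizeConstant C c₀ ∧ C ^ 2 * c₀ ^ 2 ≤ sizeConstant C c₀ ∧
    C ^ 2 ≤ sizeConstant C c₀ ∧ 2 * C ≤ sizeConstant C c₀ := by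
  have hD : 1 ≤ 1 + C := by linarith
  have hCD : C ≤ 1 + C := by linarith
  have e : 1 ≤ c₀ ^ 2 := one_le_pow₀ hc₀
  have d4 : 1 ≤ (1 + C) ^ 4 := one_le_pow₀ hD
  have p24 : C ^ 2 ≤ (1 + C) ^ 4 := (pow_le_pow_left₀ hC.le hCD 2).trans
    (pow_le_pow_right₀ hD (by norm_num))
  have p14 : C ≤ (1 + C) ^ 4 := hCD.trans (le_self_pow₀ hD (by norm_num))
  have p34 : C ^ 3 ≤ (1 + C) ^ 4 := (pow_le_pow_left₀ hC.le hCD 3).trans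
    (pow_le_pow_right₀ hD (by norm_num))
  have p44 : C ^ 4 ≤ (1 + C) ^ 4 := pow_le_pow_left₀ hC.le hCD 4
  have key : ∀ z, z ≤ 9 * (1 + C) ^ 4 → z ≤ 9 * (1 + C) ^ 4 * c₀ ^ 2 := fun z hz =>
    hz.trans (le_mul_of_one_le_right (by positivity) e)
  have key2 : ∀ z, z ≤ 9 * (1 + C) ^ 4 → z * c₀ ^ 2 ≤ 9 * (1 + C) ^ 4 * c₀ ^ 2 := fun z hz =>
    mul_le_mul_of_nonneg_right hz (sq_nonneg _)
  unfold sizeConstant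
  refine ⟨key _ (by linarith), ?_, ?_, ?_, key2 _ (by linarith), key _ (by linarith),
    key _ (by linarith)⟩
  · have := key2 1 (by linarith)
    nlinarith
  · have := key2 (9 * C ^ 4) (by linarith)
    linarith
  · have := key2 (6 * C ^ 3) (by linarith)
    linarith

set_option maxHeartbeats 1000000 in
/-- Bounds of the weighted norms of the perturbation by the total size `G` of the scores. -/
lemma GapFacts.exists_norms {j : ℕ+} {C h m t W : ℝ} (hg : M.GapFacts j C h m t W)
    (h0 : ∀ k, 0 ≤ M.lam k) (hC : 0 < C) {u c₀ σ G : ℝ} (hu : 0 < u) (hum : u * √m = 1)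
    (hc₀ : 1 ≤ c₀) (ht : 0 ≤ t) (hσ : 0 ≤ σ) (hG : 0 ≤ G) {τ : ℕ+ × ℕ+ → ℝ} (hτ : ∀ kl, 0 ≤ τ kl)
    (hGs : HasSum (fun kl => M.scoreWeight j W kl * τ kl ^ 2) (G ^ 2)) {S R : ℕ+ → ℕ+ → ℝ}
    (hSR : ∀ k l, (S k l - R k l) ^ 2 ≤ C ^ 2 * c₀ ^ 2 * (M.lam k * M.lam l) * (u * τ (k, l)) ^ 2)
    (hS : |S j j| ≤ C * M.lam j * (u * τ (j, j)))
    (hR : ∀ k l, R k l ^ 2 ≤ C ^ 2 * (M.lam k * M.lam l) * (σ * (u * τ (k, l))) ^ 2) :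
    ∃ N B A Q : ℝ,
      HasSum (fun kl : ℕ+ × ℕ+ => (S kl.1 kl.2 - R kl.1 kl.2) ^ 2 /
        (M.gapWeight j W kl.1 * M.gapWeight j W kl.2)) N ∧
      HasSum (fun kl : ℕ+ × ℕ+ =>
        (if kl.1 = j then 0 else M.gapWeight j W j / M.gapWeight j W kl.1 ^ 2) *
        ((S kl.1 kl.2 - R kl.1 kl.2) ^ 2 / M.gapWeight j W kl.2)) B ∧
      HasSum (fun k : {k // k ≠ j} => (R k j / (M.lam j - M.lam k)) ^ 2) A ∧
      HasSum (fun kl : ℕ+ × ℕ+ => (S kl.1 kl.2 - R kl.1 kl.2) ^ 2) Q ∧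
      0 ≤ N ∧ 0 ≤ B ∧ 0 ≤ A ∧
      N ≤ sizeConstant C c₀ * (t * G) ^ 2 ∧
      M.gapWeight j W j * N ≤ sizeConstant C c₀ * (M.lam j * u * t) * G ^ 2 ∧
      B ≤ sizeConstant C c₀ * (√(M.Lambda j) * u * G) ^ 2 ∧
      A ≤ sizeConstant C c₀ * (√(M.Lambda j) * u * σ * G) ^ 2 ∧
      Q ≤ sizeConstant C c₀ * (u * G) ^ 2 ∧
      |S j j| ≤ sizeConstant C c₀ * (M.lam j * u) * G ∧
      |R j j| ≤ sizeConstant C c₀ * (M.lam j * u * σ) * G := by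
  have hγ := hg.gapWeight_pos h0
  have hW := hg.nonneg
  have hΛ := hg.Lambda_pos
  have hl := hg.lam_pos
  obtain ⟨-, -, hk1, hk2, hk3, hk4, hk5⟩ := sizeConstant_ge hC hc₀
  set c := sizeConstant C c₀ with hc
  set κ := C ^ 2 * c₀ ^ 2 with hκ
  have hκ0 : 0 ≤ κ := by positivity
  have hV : 0 < 1 + 2 * W := by linarith
  -- Both `1` and `W` are at most `C * t * √m`; this is where the gap assumption makes the relative
  -- perturbation of order `t`.
  have hVu : (1 + 2 * W) * u ≤ 3 * C * t := by
    have h1 : 1 + 2 * W ≤ 3 * (C * (t * √m)) := by linarith [hg.one_le, hg.le]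
    calc (1 + 2 * W) * u ≤ 3 * (C * (t * √m)) * u := by gcongr
      _ = 3 * C * t * (u * √m) := by ring
      _ = _ := by rw [hum, mul_one]
  have hΛs : √(M.Lambda j) ^ 2 = M.Lambda j := Real.sq_sqrt hΛ.le
  have hw1 : ∀ kl, (M.lam kl.1 / M.gapWeight j W kl.1) * (M.lam kl.2 / M.gapWeight j W kl.2) ≤
      (1 + 2 * W) ^ 2 * M.scoreWeight j W kl := by
    intro kl
    obtain ⟨h1, h2, h3⟩ := hg.weight_terms_nonneg h0 kl
    rw [← div_le_iff₀' (by positivity)]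
    unfold scoreWeight
    linarith
  have hw2 : ∀ kl, (if kl.1 = j then 0 else M.gapWeight j W j / M.gapWeight j W kl.1 ^ 2) *
      M.lam kl.1 * (M.lam kl.2 / M.gapWeight j W kl.2) ≤ M.Lambda j * M.scoreWeight j W kl := by
    intro kl
    obtain ⟨h1, h2, h3⟩ := hg.weight_terms_nonneg h0 kl
    rw [← div_le_iff₀' hΛ]
    unfold scoreWeight
    linarith
  have hw3 : ∀ kl, M.lam kl.1 * M.lam kl.2 ≤ M.scoreWeight j W kl := by
    intro kl
    obtain ⟨h1, h2, h3⟩ := hg.weight_terms_nonneg h0 kl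
    unfold scoreWeight
    linarith
  obtain ⟨N, hN, hN0, hNle⟩ := hGs.exists_hasSum_le
    (f := fun kl : ℕ+ × ℕ+ => (S kl.1 kl.2 - R kl.1 kl.2) ^ 2 /
        (M.gapWeight j W kl.1 * M.gapWeight j W kl.2)) (κ := κ * ((1 + 2 * W) * u) ^ 2)
    (fun kl => div_nonneg (sq_nonneg _) (mul_pos (hγ _) (hγ _)).le) (fun kl => by
      calc _ ≤ κ * (M.lam kl.1 * M.lam kl.2) * (u * τ kl) ^ 2 /
            (M.gapWeight j W kl.1 * M.gapWeight j W kl.2) :=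
            div_le_div_of_nonneg_right (hSR kl.1 kl.2) (mul_pos (hγ _) (hγ _)).le
        _ = κ * (u * τ kl) ^ 2 * ((M.lam kl.1 / M.gapWeight j W kl.1) *
            (M.lam kl.2 / M.gapWeight j W kl.2)) := by
            have := (hγ kl.1).ne'
            have := (hγ kl.2).ne'
            field_simp
        _ ≤ κ * (u * τ kl) ^ 2 * ((1 + 2 * W) ^ 2 * M.scoreWeight j W kl) :=
            mul_le_mul_of_nonneg_left (hw1 kl) (by positivity)
        _ = _ := by ring)
  obtain ⟨B, hB, hB0, hBle⟩ := hGs.exists_hasSum_le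
    (f := fun kl : ℕ+ × ℕ+ =>
        (if kl.1 = j then 0 else M.gapWeight j W j / M.gapWeight j W kl.1 ^ 2) *
        ((S kl.1 kl.2 - R kl.1 kl.2) ^ 2 / M.gapWeight j W kl.2)) (κ := κ * u ^ 2 * M.Lambda j)
    (fun kl => mul_nonneg (hg.relativeSq_nonneg h0 _) (div_nonneg (sq_nonneg _) (hγ _).le))
    (fun kl => by
      have hβ := hg.relativeSq_nonneg h0 kl.1
      calc _ ≤ (if kl.1 = j then 0 else M.gapWeight j W j / M.gapWeight j W kl.1 ^ 2) *
            (κ * (M.lam kl.1 * M.lam kl.2) * (u * τ kl) ^ 2 / M.gapWeight j W kl.2) :=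
            mul_le_mul_of_nonneg_left
              (div_le_div_of_nonneg_right (hSR kl.1 kl.2) (hγ _).le) hβ
        _ = κ * (u * τ kl) ^ 2 *
            ((if kl.1 = j then 0 else M.gapWeight j W j / M.gapWeight j W kl.1 ^ 2) *
            M.lam kl.1 * (M.lam kl.2 / M.gapWeight j W kl.2)) := by ring
        _ ≤ κ * (u * τ kl) ^ 2 * (M.Lambda j * M.scoreWeight j W kl) :=
            mul_le_mul_of_nonneg_left (hw2 kl) (by positivity)
        _ = _ := by ring)
  obtain ⟨Q, hQ, -, hQle⟩ := hGs.exists_hasSum_le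
    (f := fun kl : ℕ+ × ℕ+ => (S kl.1 kl.2 - R kl.1 kl.2) ^ 2) (κ := κ * u ^ 2)
    (fun kl => sq_nonneg _) (fun kl => by
      calc _ ≤ κ * (M.lam kl.1 * M.lam kl.2) * (u * τ kl) ^ 2 := hSR kl.1 kl.2
        _ = κ * (u * τ kl) ^ 2 * (M.lam kl.1 * M.lam kl.2) := by ring
        _ ≤ κ * (u * τ kl) ^ 2 * M.scoreWeight j W kl :=
            mul_le_mul_of_nonneg_left (hw3 kl) (by positivity)
        _ = _ := by ring)
  have hinj : Function.Injective fun k : {k : ℕ+ // k ≠ j} => ((k : ℕ+), j) :=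
    fun a b hab => Subtype.ext (Prod.ext_iff.1 hab).1
  have hGc := hGs.summable.comp_injective hinj
  have hGcle : ∑' k : {k : ℕ+ // k ≠ j}, M.scoreWeight j W (k, j) * τ (k, j) ^ 2 ≤ G ^ 2 := by
    rw [← hGs.tsum_eq]
    exact hGc.tsum_le_tsum_of_inj _ hinj
      (fun kl _ => mul_nonneg (hg.scoreWeight_nonneg h0 kl) (sq_nonneg _)) (fun k => le_rfl)
      hGs.summable
  have hGc' : HasSum (fun k : {k : ℕ+ // k ≠ j} => M.scoreWeight j W (k, j) * τ (k, j) ^ 2) _ :=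
    hGc.hasSum
  obtain ⟨A, hA, hA0, hAle⟩ := hGc'.exists_hasSum_le
    (f := fun k : {k // k ≠ j} => (R k j / (M.lam j - M.lam k)) ^ 2)
    (κ := C ^ 2 * σ ^ 2 * u ^ 2 * M.Lambda j) (fun k => sq_nonneg _) (fun k => by
      have hd : (M.lam j - M.lam k) ^ 2 = M.gapWeight j W k ^ 2 := by
        rw [gapWeight_of_ne k.2, sq_abs]
      have hk := hw2 (k, j)
      simp only [if_neg k.2] at hk
      rw [div_pow, hd]
      calc _ ≤ C ^ 2 * (M.lam k * M.lam j) * (σ * (u * τ (k, j))) ^ 2 / M.gapWeight j W k ^ 2 :=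
            div_le_div_of_nonneg_right (hR k j) (sq_nonneg _)
        _ = C ^ 2 * (σ * (u * τ (k, j))) ^ 2 * (M.gapWeight j W j / M.gapWeight j W k ^ 2 *
              M.lam k * (M.lam j / M.gapWeight j W j)) := by
            have := (hγ k).ne'
            have := (hγ j).ne'
            field_simp
        _ ≤ C ^ 2 * (σ * (u * τ (k, j))) ^ 2 * (M.Lambda j * M.scoreWeight j W (k, j)) :=
            mul_le_mul_of_nonneg_left hk (by positivity)
        _ = _ := by ring)
  have hτj : τ (j, j) ≤ 2 * G := by
    have h1 := le_hasSum hGs (j, j) fun kl _ =>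
      mul_nonneg (hg.scoreWeight_nonneg h0 kl) (sq_nonneg _)
    have h2 := mul_le_mul_of_nonneg_right (hg.scoreWeight_diag h0) (sq_nonneg (τ (j, j)))
    refine abs_le_of_sq_le_sq' ?_ (by positivity) |>.2
    nlinarith
  refine ⟨N, B, A, Q, hN, hB, hA, hQ, hN0, hB0, hA0, ?_, ?_, ?_, ?_, ?_, ?_, ?_⟩
  · calc N ≤ κ * ((1 + 2 * W) * u) ^ 2 * G ^ 2 := hNle
      _ ≤ κ * (3 * C * t) ^ 2 * G ^ 2 := by gcongr
      _ = 9 * κ * C ^ 2 * (t * G) ^ 2 := by ring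
      _ ≤ _ := by gcongr
  -- One factor `1 + 2 * W` of the bound for `N` is absorbed by `γ j`, the other becomes `t`. The
  -- eigenvalue remainder is therefore relative to `lam j`.
  · have hγj : M.gapWeight j W j * (1 + 2 * W) ≤ 2 * M.lam j := by
      rw [gapWeight_self, div_mul_eq_mul_div, div_le_iff₀ (by linarith)]
      nlinarith
    calc M.gapWeight j W j * N ≤ M.gapWeight j W j * (κ * ((1 + 2 * W) * u) ^ 2 * G ^ 2) :=
          mul_le_mul_of_nonneg_left hNle (hγ j).le
      _ = (M.gapWeight j W j * (1 + 2 * W)) * (κ * (((1 + 2 * W) * u) * u) * G ^ 2) := by ring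
      _ ≤ (2 * M.lam j) * (κ * ((3 * C * t) * u) * G ^ 2) := by gcongr
      _ = 6 * κ * C * (M.lam j * u * t) * G ^ 2 := by ring
      _ ≤ _ := by gcongr
  · calc B ≤ κ * u ^ 2 * M.Lambda j * G ^ 2 := hBle
      _ = κ * (√(M.Lambda j) * u * G) ^ 2 := by
        rw [mul_pow, mul_pow, hΛs]; ring
      _ ≤ _ := by gcongr
  · calc A ≤ C ^ 2 * σ ^ 2 * u ^ 2 * M.Lambda j * G ^ 2 :=
        hAle.trans (mul_le_mul_of_nonneg_left hGcle (by positivity))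
      _ = C ^ 2 * (√(M.Lambda j) * u * σ * G) ^ 2 := by
        rw [mul_pow, mul_pow, mul_pow, hΛs]; ring
      _ ≤ _ := by gcongr
  · calc Q ≤ κ * u ^ 2 * G ^ 2 := hQle
      _ = κ * (u * G) ^ 2 := by ring
      _ ≤ _ := by gcongr
  · calc |S j j| ≤ C * M.lam j * (u * (2 * G)) := hS.trans (by gcongr)
      _ = 2 * C * (M.lam j * u) * G := by ring
      _ ≤ _ := by gcongr
  · have h1 : |R j j| ≤ C * M.lam j * (σ * (u * τ (j, j))) := by
      have := hτ (j, j)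
      refine abs_le_of_sq_le_sq ((hR j j).trans_eq (by ring)) (by positivity)
    calc |R j j| ≤ C * M.lam j * (σ * (u * (2 * G))) := h1.trans (by gcongr)
      _ = 2 * C * (M.lam j * u * σ) * G := by ring
      _ ≤ _ := by gcongr

end EigenModel

/-! ### Bounds for each realization and their ingredients. -/

namespace EigenModel

set_option maxHeartbeats 1000000 in
/-- Bounds of the errors of the expansions for one realization, in terms of the total size `G` of
the scores. -/
theorem exists_pathwise_constant {C c₀ : ℝ} (hC : 0 < C) (hc₀ : 1 ≤ c₀) (d : ℕ) :
    ∃ K : ℝ, 1 ≤ K ∧ ∀ {Ω : Type u} {H : Type v} [NormedAddCommGroup H] [InnerProductSpace ℝ H]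
      [CompleteSpace H] (M : EigenModel Ω H) (j : ℕ+) (h m t W u σ G : ℝ)
      (τ : ℕ+ × ℕ+ → ℝ) (S R : ℕ+ → ℕ+ → ℝ) (Dh : H →L[ℝ] H) (μ : ℕ+ → ℝ) (v : ℕ+ → H)
      (_ : M.GapFacts j C h m t W) (_ : 0 < u) (_ : u * √m = 1) (_ : 0 < t) (_ : t ≤ 1)
      (_ : t ≤ σ) (_ : σ ≤ c₀) (_ : 0 ≤ G) (_ : 0 < m ^ (-h)) (_ : m ^ (-h) ≤ 1)
      (_ : m ^ (-h) ≤ u ^ 2) (_ : t ^ (2 * d) ≤ (m ^ (-h)) ^ 2)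
      (_ : ∀ kl, 0 ≤ τ kl) (_ : HasSum (fun kl => M.scoreWeight j W kl * τ kl ^ 2) (G ^ 2))
      (_ : ∀ k l, (S k l - R k l) ^ 2 ≤
        C ^ 2 * c₀ ^ 2 * (M.lam k * M.lam l) * (u * τ (k, l)) ^ 2)
      (_ : |S j j| ≤ C * M.lam j * (u * τ (j, j)))
      (_ : ∀ k l, R k l ^ 2 ≤ C ^ 2 * (M.lam k * M.lam l) * (σ * (u * τ (k, l))) ^ 2)
      (_ : IsEntryPerturbation M.D Dh M.lam M.e fun i k => S i k - R i k)
      (_ : IsOrderedEigensystem Dh μ v) (_ : 0 ≤ inner ℝ (v j) (M.e j)),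
      (Summable fun k : {k // k ≠ j} => (S k j / (M.lam j - M.lam k)) ^ 2) ∧
      |μ j - M.lam j - S j j| ≤ K * (M.lam j * u * σ) * (1 + G) ^ (2 * d + 5) ∧
      ‖v j - M.e j + (‖v j - M.e j‖ ^ 2 / 2) • M.e j -
        ∑' k : {k // k ≠ j}, (S k j / (M.lam j - M.lam k)) • M.e k‖ ≤
          K * (√(M.Lambda j) * u * σ) * (1 + G) ^ (2 * d + 5) ∧
      |‖v j - M.e j‖ ^ 2 - ∑' k : {k // k ≠ j}, (S k j / (M.lam j - M.lam k)) ^ 2| ≤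
          K * ((√(M.Lambda j) * u) ^ 2 * σ) * (1 + G) ^ (2 * d + 5) ∧
      |μ j - M.lam j| ≤ K * (M.lam j * u) * (1 + G) ^ (2 * d + 5) ∧
      ‖v j - M.e j‖ ^ 2 ≤ K * (√(M.Lambda j) * u) ^ 2 * (1 + G) ^ (2 * d + 5) := by
  obtain ⟨hc1, hcc₀, -, -, -, hk4, hk5⟩ := sizeConstant_ge hC hc₀
  -- Of the exponent, `2 * d` pays for `(m ^ (-h)) ^ 2`, which lies below `lam j`, `p` and `p ^ 2`
  -- up to constants; the last factor `t` is the rate.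
  obtain ⟨K, hK1, hK⟩ := exists_error_constant _ hc1 (2 * d + 1)
  set c := sizeConstant C c₀ with hc
  have hc0 : 0 < c := by linarith
  have hK0 : 0 < K := by linarith
  have hKc : K ≤ K * c₀ := le_mul_of_one_le_right hK0.le hc₀
  refine ⟨K * c₀ + (2 * c + 2 * c * c₀ ^ 2), ?_, ?_⟩
  · have : 0 ≤ 2 * c + 2 * c * c₀ ^ 2 := by positivity
    linarith
  intro Ω H _ _ _ M j h m t W u σ G τ S R Dh μ v hg hu hum ht ht1 htσ hσ hG hy0 hy1 hyu hty hτ hGs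
    hSR hS hR hE hs hsign
  have h0 := hE.nonneg
  have hl := hg.lam_pos
  have hΛ := hg.Lambda_pos
  have hσ0 : 0 < σ := ht.trans_le htσ
  have hΛs : √(M.Lambda j) ^ 2 = M.Lambda j := Real.sq_sqrt hΛ.le
  obtain ⟨N, B, A, Q, hN, hB, hA, hQ, hN0, hB0, hA0, bN, bg, bB, bA, bQ, bS, bR⟩ :=
    hg.exists_norms h0 hC hu hum hc₀ ht.le hσ0.le hG hτ hGs hSR hS hR
  obtain ⟨hsum, hF, hgood, hb1, hb2, hb3⟩ := hE.error_bounds hs (hg.isGapWeight h0) hN hB hA hQ hsign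
    rfl rfl rfl rfl
  have hGX : G ≤ 1 + G := by linarith
  have hX : 1 ≤ 1 + G := by linarith
  set X := 1 + G with hXdef
  have hX0 : 0 < X := by linarith
  set p := √(M.Lambda j) * u with hp
  have hp0 : 0 < p := mul_pos (Real.sqrt_pos.2 hΛ) hu
  have hp2 : p ^ 2 = M.Lambda j * u ^ 2 := by rw [hp, mul_pow, hΛs]
  set y := m ^ (-h) with hy
  have hm0 : 0 ≤ m := by
    by_contra hcon
    rw [Real.sqrt_eq_zero_of_nonpos (by linarith)] at hum
    simp at hum
  have hu2 : m * u ^ 2 = 1 := by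
    have : (u * √m) ^ 2 = m * u ^ 2 := by rw [mul_pow, Real.sq_sqrt hm0]; ring
    rw [← this, hum, one_pow]
  have hCc : C ≤ c := by linarith
  have hpt : p ≤ c * t := by
    have h1 : p ^ 2 ≤ C * t ^ 2 := by
      rw [hp2]
      calc M.Lambda j * u ^ 2 ≤ C * (t ^ 2 * m) * u ^ 2 := by
            have := hg.Lambda_le
            gcongr
        _ = C * t ^ 2 * (m * u ^ 2) := by ring
        _ = _ := by rw [hu2, mul_one]
    refine abs_le_of_sq_le_sq' (h1.trans ?_) (by positivity) |>.2
    rw [mul_pow]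
    have : C ≤ c ^ 2 := hCc.trans (le_self_pow₀ hc1 two_ne_zero)
    gcongr
  have htr : t ^ (2 * d + 1) ≤ t * y ^ 2 := by
    rw [pow_succ, mul_comm]
    gcongr
  have hyy : y ^ 2 ≤ y := by rw [sq]; exact mul_le_of_le_one_left hy0.le hy1
  have hr1 : t ^ (2 * d + 1) ≤ c * (t * M.lam j) := by
    have h1 : y ^ 2 ≤ c * M.lam j :=
      hyy.trans (hg.lam_lower.trans (mul_le_mul_of_nonneg_right hCc hl.le))
    exact htr.trans ((mul_le_mul_of_nonneg_left h1 ht.le).trans_eq (by ring))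
  -- One factor `y` is spent on `Lambda j`, the other on `u ^ 2`.
  have hyP : y ^ 2 ≤ C ^ 2 * p ^ 2 := by
    rw [hp2]
    calc y ^ 2 = y * y := by ring
      _ ≤ (C ^ 2 * M.Lambda j) * u ^ 2 := mul_le_mul hg.Lambda_lower hyu hy0.le (by positivity)
      _ = _ := by ring
  have hr3 : t ^ (2 * d + 1) ≤ c * (t * p ^ 2) := by
    have h1 : y ^ 2 ≤ c * p ^ 2 := hyP.trans (by gcongr)
    exact htr.trans ((mul_le_mul_of_nonneg_left h1 ht.le).trans_eq (by ring))
  have hr2 : t ^ (2 * d + 1) ≤ c * (t * p) := by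
    have h1 : y ≤ C * p := by
      refine abs_le_of_sq_le_sq' ?_ (by positivity) |>.2
      rw [mul_pow]; exact hyP
    have h2 : y ^ 2 ≤ c * p := hyy.trans (h1.trans (by gcongr))
    exact htr.trans ((mul_le_mul_of_nonneg_left h2 ht.le).trans_eq (by ring))
  have bB' : B ≤ c * (p * X) ^ 2 := bB.trans (by gcongr)
  have bA' : A ≤ c * (p * σ * X) ^ 2 := bA.trans (by gcongr)
  have bS' : |S j j| ≤ c * (M.lam j * u) * X := bS.trans (by gcongr)
  obtain ⟨r1, r2, r3⟩ := hK (M.lam j) p u t σ X N B A Q (M.gapWeight j W j * N) |S j j| |R j j|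
    _ _ _ hl.le hp0.le hu.le ht ht1 htσ (hσ.trans hcc₀) hX hpt hN0 hB0 hA0 (norm_nonneg _)
    (bN.trans (by gcongr)) (bg.trans (by gcongr)) bB' bA' (bQ.trans (by gcongr)) bS'
    (bR.trans (by gcongr)) hr1 hr2 hr3 hgood hb1 hb2 hb3
  rw [show 2 * d + 1 + 4 = 2 * d + 5 by omega] at r1 r2 r3
  clear hK hgood hb1 hb2 hb3
  clear_value X p y c
  have hKK : K ≤ K * c₀ + (2 * c + 2 * c * c₀ ^ 2) := by
    have : 0 ≤ 2 * c + 2 * c * c₀ ^ 2 := by positivity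
    linarith
  have hXk : 1 ≤ X ^ (2 * d + 5) := one_le_pow₀ hX
  have hXk1 : X ≤ X ^ (2 * d + 5) := le_self_pow₀ hX (by omega)
  have hXk2 : X ^ 2 ≤ X ^ (2 * d + 5) := pow_le_pow_right₀ hX (by omega)
  have hcc : c ≤ 2 * c + 2 * c * c₀ ^ 2 := by
    have : 0 ≤ 2 * c * c₀ ^ 2 := by positivity
    linarith
  refine ⟨hsum, r1.trans (by gcongr), r2.trans (by gcongr), r3.trans (by gcongr), ?_, ?_⟩
  · calc |μ j - M.lam j| = |(μ j - M.lam j - S j j) + S j j| := by congr 1; ring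
      _ ≤ |μ j - M.lam j - S j j| + |S j j| := abs_add_le _ _
      _ ≤ K * (M.lam j * u * σ) * X ^ (2 * d + 5) + c * (M.lam j * u) * X := add_le_add r1 bS'
      _ ≤ K * (M.lam j * u * c₀) * X ^ (2 * d + 5) +
          (2 * c + 2 * c * c₀ ^ 2) * (M.lam j * u) * X ^ (2 * d + 5) := by gcongr
      _ = _ := by ring
  · have h1 := (abs_le.1 r3).2
    have h2 : 2 * B + 2 * A ≤ (2 * c + 2 * c * c₀ ^ 2) * p ^ 2 * X ^ (2 * d + 5) := by
      calc 2 * B + 2 * A ≤ 2 * (c * (p * X) ^ 2) + 2 * (c * (p * σ * X) ^ 2) := by linarith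
        _ ≤ 2 * (c * (p * X) ^ 2) + 2 * (c * (p * c₀ * X) ^ 2) := by gcongr
        _ = (2 * c + 2 * c * c₀ ^ 2) * p ^ 2 * X ^ 2 := by ring
        _ ≤ _ := by gcongr
    calc ‖v j - M.e j‖ ^ 2 ≤ K * (p ^ 2 * σ) * X ^ (2 * d + 5) + (2 * B + 2 * A) :=
          (sub_le_iff_le_add.1 h1).trans (add_le_add_right hF _)
      _ ≤ K * (p ^ 2 * c₀) * X ^ (2 * d + 5) +
          (2 * c + 2 * c * c₀ ^ 2) * p ^ 2 * X ^ (2 * d + 5) := add_le_add (by gcongr) h2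
      _ = _ := by ring

variable {Ω H : Type*} [NormedAddCommGroup H] [InnerProductSpace ℝ H] {M : EigenModel Ω H}
variable [MeasurableSpace Ω] {P : Measure Ω} {a h p C m s : ℝ} {Jp j : ℕ+}

/-- The power `2 * ⌈h / a⌉₊ + 5` of `1 + G` must be integrable to order `p`, and `2 * d + 5 ≤ 2 ^ (d
+ 4)`. -/
lemma momentOrder_ge (hp : 1 ≤ p) : 2 ≤ momentOrder a h p ∧
    p * ((2 * ⌈h / a⌉₊ + 5 : ℕ) : ℝ) ≤ momentOrder a h p := by
  have h1 : ⌈h / a⌉₊ < 2 ^ ⌈h / a⌉₊ := Nat.lt_two_pow_self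
  have h2 : 2 * ⌈h / a⌉₊ + 5 ≤ 2 ^ (⌈h / a⌉₊ + 4) := by rw [pow_add]; omega
  have h3 : ((2 * ⌈h / a⌉₊ + 5 : ℕ) : ℝ) ≤ 2 ^ (⌈h / a⌉₊ + 4) := by exact_mod_cast h2
  have h4 : p * ((2 * ⌈h / a⌉₊ + 5 : ℕ) : ℝ) ≤ momentOrder a h p :=
    mul_le_mul_of_nonneg_left h3 (by linarith)
  refine ⟨le_trans ?_ h4, h4⟩
  push_cast
  have : (0 : ℝ) ≤ ⌈h / a⌉₊ := Nat.cast_nonneg _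
  nlinarith

/-- The total size of the scores, with its moment bound. -/
lemma SatisfiesAssumption.exists_size (hM : M.SatisfiesAssumption P a h p C m s Jp) (hC : 0 < C)
    (hp : 1 ≤ p) (hm : 1 ≤ m) {σ : ℝ} (hσ : 0 < σ) (hsσ : s ≤ σ) (hj : j < Jp) :
    ∃ G : Ω → ℝ, AEStronglyMeasurable G P ∧ (∀ ω, 0 ≤ G ω) ∧
      eLpNorm G (ENNReal.ofReal (momentOrder a h p)) P ≤
        ENNReal.ofReal (√(3 + C ^ 2) * (C + 1)) ∧
      ∀ᵐ ω ∂P, HasSum (fun kl => M.scoreWeight j (M.gapSum j).toReal kl *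
        M.scoreSize P m σ kl ω ^ 2) (G ω ^ 2) := by
  have hg := hM.gapFacts hC hm hj
  have h0 := hM.represented.lam_nonneg
  have hsum := hg.hasSum_scoreWeight h0 hM.represented.lam_summable
  have hq := (momentOrder_ge (a := a) (h := h) hp).1
  refine exists_weighted_l2_norm (hg.scoreWeight_nonneg h0) hsum.summable ?_
    hM.aestronglyMeasurable_scoreSize hq
    (hM.eLpNorm_scoreSize_le hC hσ hsσ (by linarith))
  rw [hsum.tsum_eq]
  have hW := hg.nonneg
  have h1 : (1 + 2 * (M.gapSum j).toReal) / (1 + (M.gapSum j).toReal) ≤ 2 := by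
    rw [div_le_iff₀ (by linarith)]; linarith
  have h2 := hM.trace_bound
  have h3 : 0 ≤ ∑' k, M.lam k := tsum_nonneg h0
  nlinarith

lemma SatisfiesAssumption.sqrt_lamT_sq_le (hM : M.SatisfiesAssumption P a h p C m s Jp)
    (hC : 0 < C) (k l : ℕ+) :
    √(M.lamT k * M.lamT l) ^ 2 ≤ C ^ 2 * (M.lam k * M.lam l) := by
  have h1 := hM.represented.lamT_nonneg
  rw [Real.sq_sqrt (mul_nonneg (h1 k) (h1 l))]
  calc M.lamT k * M.lamT l ≤ (C * M.lam k) * (C * M.lam l) :=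
        mul_le_mul (hM.lamT_le hC k) (hM.lamT_le hC l) (h1 l)
          (mul_nonneg hC.le (hM.represented.lam_nonneg k))
    _ = _ := by ring

lemma SatisfiesAssumption.score_bounds (hM : M.SatisfiesAssumption P a h p C m s Jp)
    (hC : 0 < C) {u σ c₀ : ℝ} (hu : 0 < u) (hum : u * √m = 1) (hσ : 0 < σ) (hσc : 1 + σ ≤ c₀)
    (ω : Ω) :
    (∀ k l, (M.scoreTerm P k l ω - M.negligibleTerm k l ω) ^ 2 ≤
      C ^ 2 * c₀ ^ 2 * (M.lam k * M.lam l) * (u * M.scoreSize P m σ (k, l) ω) ^ 2) ∧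
    |M.scoreTerm P j j ω| ≤ C * M.lam j * (u * M.scoreSize P m σ (j, j) ω) ∧
    (∀ k l, M.negligibleTerm k l ω ^ 2 ≤
      C ^ 2 * (M.lam k * M.lam l) * (σ * (u * M.scoreSize P m σ (k, l) ω)) ^ 2) := by
  have hum' : ∀ z, u * (√m * z) = z := fun z => by rw [← mul_assoc, hum, one_mul]
  have hb : ∀ k l, |M.etaBar P k l ω| ≤ u * M.scoreSize P m σ (k, l) ω := fun k l => by
    have := mul_le_mul_of_nonneg_left (abs_etaBar_le (P := P) (M := M) (m := m) hσ.le k l ω) hu.le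
    rwa [hum'] at this
  have hr : ∀ k l, |M.etaR k l ω| ≤ σ * (u * M.scoreSize P m σ (k, l) ω) := fun k l => by
    have := mul_le_mul_of_nonneg_left (abs_etaR_le (P := P) (M := M) (m := m) hσ k l ω) hu.le
    rw [hum'] at this
    linarith
  have hl := hM.represented.lam_nonneg
  refine ⟨fun k l => ?_, ?_, fun k l => ?_⟩
  · have h1 : M.scoreTerm P k l ω - M.negligibleTerm k l ω =
      √(M.lamT k * M.lamT l) * (M.etaBar P k l ω - M.etaR k l ω) := by
      unfold scoreTerm negligibleTerm; ring
    have h2 : |M.etaBar P k l ω - M.etaR k l ω| ≤ c₀ * (u * M.scoreSize P m σ (k, l) ω) := by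
      have h3 := (abs_sub (M.etaBar P k l ω) (M.etaR k l ω)).trans (add_le_add (hb k l) (hr k l))
      have h4 : 0 ≤ u * M.scoreSize P m σ (k, l) ω := (abs_nonneg _).trans (hb k l)
      nlinarith
    rw [h1, mul_pow, ← sq_abs (_ - _)]
    calc _ ≤ C ^ 2 * (M.lam k * M.lam l) * (c₀ * (u * M.scoreSize P m σ (k, l) ω)) ^ 2 :=
          mul_le_mul (hM.sqrt_lamT_sq_le hC k l) (pow_le_pow_left₀ (abs_nonneg _) h2 2)
            (sq_nonneg _) (mul_nonneg (sq_nonneg _) (mul_nonneg (hl k) (hl l)))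
      _ = _ := by ring
  · have hT := hM.represented.lamT_nonneg j
    unfold scoreTerm
    rw [Real.sqrt_mul_self hT, abs_mul, abs_of_nonneg hT]
    exact mul_le_mul (hM.lamT_le hC j) (hb j j) (abs_nonneg _) (mul_nonneg hC.le (hl j))
  · unfold negligibleTerm
    rw [mul_pow, ← sq_abs (M.etaR k l ω)]
    exact mul_le_mul (hM.sqrt_lamT_sq_le hC k l) (pow_le_pow_left₀ (abs_nonneg _) (hr k l) 2)
      (sq_nonneg _) (mul_nonneg (sq_nonneg _) (mul_nonneg (hl k) (hl l)))

end EigenModel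

/-! ### Uniform random bounds and the theorem. -/

namespace EigenModel

/-- The errors of the expansions at an index below `Jp` are almost surely bounded by a random
variable with bounded moments. -/
theorem exists_pointwise_constant {a h p C S₀ : ℝ} (ha : 0 < a) (hh : 1 ≤ h) (hp : 1 ≤ p)
    (hC : 0 < C) (hS₀ : 0 ≤ S₀) :
    ∃ K : ℝ, 1 ≤ K ∧ ∀ {Ω : Type u} [MeasurableSpace Ω] (P : Measure Ω) [IsProbabilityMeasure P]
      {H : Type v} [NormedAddCommGroup H] [InnerProductSpace ℝ H] [CompleteSpace H]
      (M : EigenModel Ω H) (m s : ℝ) (Jp j : ℕ+) (_ : 1 ≤ m) (_ : 0 ≤ s) (_ : s ≤ S₀)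
      (_ : M.SatisfiesAssumption P a h p C m s Jp) (_ : j < Jp),
      0 < M.lam j ∧ 0 < M.Lambda j ∧
      ∃ g : Ω → ℝ, AEStronglyMeasurable g P ∧
        (∀ δ, 0 ≤ δ → eLpNorm (fun ω => δ * g ω) (ENNReal.ofReal p) P ≤ ENNReal.ofReal (K * δ)) ∧
        ∀ᵐ ω ∂P,
        Summable (fun k : {k : ℕ+ // k ≠ j} =>
            (M.scoreTerm P k j ω / (M.lam j - M.lam k)) • M.e k) ∧
        Summable (fun k : {k : ℕ+ // k ≠ j} =>
            (M.scoreTerm P k j ω) ^ 2 / (M.lam j - M.lam k) ^ 2) ∧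
        |M.lamHat j ω - M.lam j - M.scoreTerm P j j ω| ≤
          M.lam j * ((m ^ (-a) + s) / √m) * g ω ∧
        ‖M.eHat j ω - M.e j + (‖M.eHat j ω - M.e j‖ ^ 2 / 2) • M.e j -
          ∑' k : {k : ℕ+ // k ≠ j}, (M.scoreTerm P k j ω / (M.lam j - M.lam k)) • M.e k‖ ≤
          √(M.Lambda j) * ((m ^ (-a) + s) / √m) * g ω ∧
        |‖M.eHat j ω - M.e j‖ ^ 2 -
          ∑' k : {k : ℕ+ // k ≠ j}, (M.scoreTerm P k j ω) ^ 2 / (M.lam j - M.lam k) ^ 2| ≤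
          M.Lambda j * ((m ^ (-a) + s) / m) * g ω ∧
        |M.lamHat j ω - M.lam j| ≤ M.lam j / √m * g ω ∧
        ‖M.eHat j ω - M.e j‖ ^ 2 ≤ M.Lambda j / m * g ω := by
  -- This constant dominates `1 + σ`, since `m ^ (-a) ≤ 1` and `s ≤ S₀`.
  have hc₀ : 1 ≤ 2 + S₀ := by linarith
  obtain ⟨K, hK1, hK⟩ := exists_pathwise_constant.{u, v} hC hc₀ ⌈h / a⌉₊
  have hb0 : 0 ≤ √(3 + C ^ 2) * (C + 1) := by positivity
  refine ⟨K * (1 + √(3 + C ^ 2) * (C + 1)) ^ (2 * ⌈h / a⌉₊ + 5), ?_, ?_⟩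
  · exact one_le_mul_of_one_le_of_one_le hK1 (one_le_pow₀ (by linarith))
  intro Ω _ P _ H _ _ _ M m s Jp j hm hs0 hsS hM hj
  have hm0 : 0 < m := by linarith
  have hsm : 0 < √m := Real.sqrt_pos.2 hm0
  have ht : 0 < m ^ (-a) := Real.rpow_pos_of_pos hm0 _
  have ht1 : m ^ (-a) ≤ 1 := Real.rpow_le_one_of_one_le_of_nonpos hm (by linarith)
  -- Including `m ^ (-a)` in `σ` keeps the division by `σ` legitimate when `s = 0`.
  have hσ : 0 < m ^ (-a) + s := by linarith
  have hg := hM.gapFacts hC hm hj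
  have hum : (√m)⁻¹ * √m = 1 := inv_mul_cancel₀ hsm.ne'
  have hu2 : (√m)⁻¹ ^ 2 = m⁻¹ := by rw [inv_pow, Real.sq_sqrt hm0.le]
  have hyu : m ^ (-h) ≤ (√m)⁻¹ ^ 2 := by
    rw [hu2, ← Real.rpow_neg_one]
    exact Real.rpow_le_rpow_of_exponent_le hm (by linarith)
  have hty : (m ^ (-a)) ^ (2 * ⌈h / a⌉₊) ≤ (m ^ (-h)) ^ 2 := by
    rw [← Real.rpow_natCast, ← Real.rpow_natCast, ← Real.rpow_mul hm0.le, ← Real.rpow_mul hm0.le]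
    refine Real.rpow_le_rpow_of_exponent_le hm ?_
    have h1 := Nat.le_ceil (h / a)
    rw [div_le_iff₀ ha] at h1
    push_cast
    nlinarith
  obtain ⟨G, hGm, hG0, hGb, hGs⟩ := hM.exists_size hC hp hm hσ (by linarith) hj
  refine ⟨hg.lam_pos, hg.Lambda_pos, fun ω => K * (1 + G ω) ^ (2 * ⌈h / a⌉₊ + 5), ?_, ?_, ?_⟩
  · exact ((aestronglyMeasurable_const.add hGm).pow _).const_mul _
  · intro δ hδ
    have h1 := eLpNorm_const_mul_one_add_pow_le hGm hG0 hp (k := 2 * ⌈h / a⌉₊ + 5) (by omega)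
      (momentOrder_ge (a := a) (h := h) hp).2 hb0 (δ := δ * K) (by positivity) hGb
    simp only [mul_assoc] at h1 ⊢
    refine h1.trans_eq ?_
    congr 1
    ring
  · filter_upwards [hGs, hM.represented.isEntryPerturbation, hM.represented.Dhat_eigen,
      hM.represented.sign_convention] with ω hω1 hω2 hω3 hω4
    obtain ⟨b1, b2, b3⟩ := hM.score_bounds (j := j) hC (inv_pos.2 hsm) hum hσ
      (c₀ := 2 + S₀) (by linarith) ω
    obtain ⟨r0, r1, r2, r3, r4, r5⟩ := hK M j h m (m ^ (-a)) (M.gapSum j).toReal (√m)⁻¹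
      (m ^ (-a) + s) (G ω) (fun kl => M.scoreSize P m (m ^ (-a) + s) kl ω)
      (fun k l => M.scoreTerm P k l ω) (fun k l => M.negligibleTerm k l ω) (M.Dhat ω)
      (fun j => M.lamHat j ω) (fun j => M.eHat j ω) hg (inv_pos.2 hsm) hum ht ht1 (by linarith)
      (by linarith) (hG0 ω) (Real.rpow_pos_of_pos hm0 _)
      (Real.rpow_le_one_of_one_le_of_nonpos hm (by linarith)) hyu hty
      (fun kl => scoreSize_nonneg hσ.le kl ω) hω1 b1 b2 b3 hω2 hω3 (hω4 j)
    have hP : (√(M.Lambda j) * (√m)⁻¹) ^ 2 = M.Lambda j / m := by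
      rw [mul_pow, hu2, Real.sq_sqrt hg.Lambda_pos.le]; rfl
    rw [hP] at r3 r5
    refine ⟨?_, ?_, ?_, ?_, ?_, ?_, ?_⟩
    · exact ((hM.represented.e_orthonormal.comp _ Subtype.val_injective).summable_smul_iff _).2 r0
    · simpa only [div_pow] using r0
    · exact r1.trans_eq (by ring)
    · exact r2.trans_eq (by ring)
    · simp only [div_pow] at r3
      exact r3.trans_eq (by ring)
    · exact r4.trans_eq (by ring)
    · exact r5.trans_eq (by ring)

end EigenModel

theorem mainTheorem3 (a h p C : ℝ) (ha : 0 < a) (hh : 1 ≤ h) (hp : 1 ≤ p) (hC : 0 < C)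
    (s : ℕ → ℝ) (hs_nonneg : ∀ n, 0 ≤ s n) (hs : Tendsto s atTop (𝓝 0)) :
    ∃ K : ℝ, 0 < K ∧
      ∀ (Ω : Type u) [MeasurableSpace Ω] (P : Measure Ω) [IsProbabilityMeasure P]
        (H : Type v) [NormedAddCommGroup H] [InnerProductSpace ℝ H] [CompleteSpace H]
        (m : ℕ → ℝ) (_ : ∀ n, 1 ≤ m n) (_ : Tendsto m atTop atTop)
        (Jp : ℕ → ℕ+) (M : ℕ → EigenModel Ω H)
        (_ : ∀ n, (M n).SatisfiesAssumption P a h p C (m n) (s n) (Jp n)),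
      ∀ n,
        -- the weights are determined by the eigenvalues and the mean scores
        (∀ j, (M n).lamT j = (M n).lam j / ∫ ω, (M n).etaD j j ω ∂P) ∧
        -- the series in the expansions converge almost surely
        (∀ j, j < Jp n → ∀ᵐ ω ∂P,
          Summable (fun k : {k : ℕ+ // k ≠ j} =>
            ((M n).scoreTerm P k j ω / ((M n).lam j - (M n).lam k)) • (M n).e k) ∧
          Summable (fun k : {k : ℕ+ // k ≠ j} =>
            ((M n).scoreTerm P k j ω) ^ 2 / ((M n).lam j - (M n).lam k) ^ 2)) ∧
        -- expansion of the eigenvalues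
        (∀ J, J < Jp n →
          eLpNorm (fun ω => maxUpTo J fun j =>
              |1 / (M n).lam j *
                ((M n).lamHat j ω - (M n).lam j - (M n).scoreTerm P j j ω)|)
            (ENNReal.ofReal p) P ≤
          ENNReal.ofReal
            (K * ((J : ℕ) : ℝ) ^ (1 / p) * ((m n) ^ (-a) + s n) / Real.sqrt (m n))) ∧
        -- expansion of the eigenvectors
        (∀ J, J < Jp n →
          eLpNorm (fun ω => maxUpTo J fun j =>
              ‖(1 / Real.sqrt ((M n).Lambda j)) •
                ((M n).eHat j ω - (M n).e j
                  + (‖(M n).eHat j ω - (M n).e j‖ ^ 2 / 2) • (M n).e j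
                  - ∑' k : {k : ℕ+ // k ≠ j},
                      ((M n).scoreTerm P k j ω / ((M n).lam j - (M n).lam k)) • (M n).e k)‖)
            (ENNReal.ofReal p) P ≤
          ENNReal.ofReal
            (K * ((J : ℕ) : ℝ) ^ (1 / p) * ((m n) ^ (-a) + s n) / Real.sqrt (m n))) ∧
        -- expansion of the squared norm of the eigenvector error
        (∀ J, J < Jp n →
          eLpNorm (fun ω => maxUpTo J fun j =>
              |1 / (M n).Lambda j *
                (‖(M n).eHat j ω - (M n).e j‖ ^ 2
                  - ∑' k : {k : ℕ+ // k ≠ j},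
                      ((M n).scoreTerm P k j ω) ^ 2 / ((M n).lam j - (M n).lam k) ^ 2)|)
            (ENNReal.ofReal p) P ≤
          ENNReal.ofReal
            (K * ((J : ℕ) : ℝ) ^ (1 / p) * ((m n) ^ (-a) + s n) / m n)) ∧
        -- norm bounds for eigenvalues and eigenvectors
        (∀ j, j < Jp n →
          eLpNorm (fun ω => (M n).lamHat j ω - (M n).lam j) (ENNReal.ofReal p) P ≤
            ENNReal.ofReal (K * (M n).lam j / Real.sqrt (m n)) ∧
          eLpNorm (fun ω => ‖(M n).eHat j ω - (M n).e j‖ ^ 2) (ENNReal.ofReal p) P ≤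
            ENNReal.ofReal (K * (M n).Lambda j / m n)) := by
  -- A bound for the whole sequence makes the constant independent of `n`.
  obtain ⟨S₀, hS₀⟩ := hs.bddAbove_range
  have hsS : ∀ n, s n ≤ S₀ := fun n => hS₀ ⟨n, rfl⟩
  obtain ⟨K, hK1, hK⟩ := EigenModel.exists_pointwise_constant.{u, v} ha hh hp hC
    ((hs_nonneg 0).trans (hsS 0))
  refine ⟨K, by linarith, ?_⟩
  intro Ω _ P _ H _ _ _ m hm _ Jp M hM n
  have hm0 : 0 < m n := by linarith [hm n]
  have hsm : 0 < √(m n) := Real.sqrt_pos.2 hm0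
  have hσ : 0 ≤ m n ^ (-a) + s n := add_nonneg (Real.rpow_nonneg hm0.le _) (hs_nonneg n)
  have hK' := fun j hj => hK P (M n) (m n) (s n) (Jp n) j (hm n) (hs_nonneg n) (hsS n) (hM n) hj
  have hδ : 0 ≤ (m n ^ (-a) + s n) / √(m n) := by positivity
  have hδ' : 0 ≤ (m n ^ (-a) + s n) / m n := by positivity
  choose! hl hΛ g hgm hgb hge using hK'
  have hmax : ∀ (J : ℕ+) (f : ℕ+ → Ω → ℝ) (δ : ℝ), J < Jp n → 0 ≤ δ → (∀ j ω, 0 ≤ f j ω) →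
      (∀ j, j < Jp n → ∀ᵐ ω ∂P, f j ω ≤ δ * g j ω) →
      eLpNorm (fun ω => maxUpTo J fun j => f j ω) (ENNReal.ofReal p) P ≤
        ENNReal.ofReal (K * δ * ((J : ℕ) : ℝ) ^ (1 / p)) := fun J f δ hJ hδ hf hfg =>
    eLpNorm_maxUpTo_le (g := fun j ω => δ * g j ω) hf
      (fun j hj => (hgm j (hj.trans_lt hJ)).const_mul δ) (fun j hj => hfg j (hj.trans_lt hJ)) hp
      (by positivity) (fun j hj => hgb j (hj.trans_lt hJ) δ hδ)
  refine ⟨(hM n).lamT_eq hC, fun j hj => ?_, fun J hJ => ?_, fun J hJ => ?_, fun J hJ => ?_,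
    fun j hj => ⟨?_, ?_⟩⟩
  · filter_upwards [hge j hj] with ω hω using ⟨hω.1, hω.2.1⟩
  · refine (hmax J _ _ hJ hδ (fun j ω => abs_nonneg _) fun j hj => ?_).trans_eq ?_
    · filter_upwards [hge j hj] with ω hω
      have hl0 := hl j hj
      rw [abs_mul, abs_of_pos (one_div_pos.2 hl0), one_div, inv_mul_le_iff₀ hl0, ← mul_assoc]
      exact hω.2.2.1
    · congr 1; ring
  · refine (hmax J _ _ hJ hδ (fun j ω => norm_nonneg _) fun j hj => ?_).trans_eq ?_
    · filter_upwards [hge j hj] with ω hω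
      have hl0 := Real.sqrt_pos.2 (hΛ j hj)
      rw [norm_smul, Real.norm_of_nonneg (one_div_pos.2 hl0).le, one_div, inv_mul_le_iff₀ hl0,
        ← mul_assoc]
      exact hω.2.2.2.1
    · congr 1; ring
  · refine (hmax J _ _ hJ hδ' (fun j ω => abs_nonneg _) fun j hj => ?_).trans_eq ?_
    · filter_upwards [hge j hj] with ω hω
      have hl0 := hΛ j hj
      rw [abs_mul, abs_of_pos (one_div_pos.2 hl0), one_div, inv_mul_le_iff₀ hl0, ← mul_assoc]
      exact hω.2.2.2.2.1
    · congr 1; ring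
  · rw [mul_div_assoc]
    refine le_trans (eLpNorm_mono_ae_real ?_)
      (hgb j hj ((M n).lam j / √(m n)) (div_nonneg (hl j hj).le hsm.le))
    filter_upwards [hge j hj] with ω hω using hω.2.2.2.2.2.1
  · rw [mul_div_assoc]
    refine le_trans (eLpNorm_mono_ae_real ?_)
      (hgb j hj ((M n).Lambda j / m n) (div_nonneg (hΛ j hj).le hm0.le))
    filter_upwards [hge j hj] with ω hω
    rw [Real.norm_of_nonneg (sq_nonneg _)]
    exact hω.2.2.2.2.2.2
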